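/- Let $n\ge 1$, $N=n^2$, and consider the discrete-time quantum walk on the torus $(\mathbb Z/n)^2$ with a two-dimensional coin space, i.e. on the Hilbert space with orthonormal basis $|v,x,y\rangle$, $v\in\{0,1\}$, $(x,y)\in(\mathbb Z/n)^2$. Let $$U=\Sigma_y\,(C_y\otimes I_N)\,\Sigma_x\,(C_x\otimes I_N),\qquad C_x=\tfrac1{\sqrt2}\begin{pmatrix}1&i\\ i&1\end{pmatrix},\quad C_y=\tfrac1{\sqrt2}\begin{pmatrix}1&-i\\ -i&1\end{pmatrix},$$ $$\Sigma_x|v,x,y\rangle=|v,x-(-1)^v,y\rangle,\qquad \Sigma_y|v,x,y\rangle=|v,x,y-(-1)^v\rangle .$$ Let $|d\rangle=\frac{1}{\sqrt2}(|0\rangle+|1\rangle)$, let $\mathcal M=\{(0,0),(x,y)\}$ be the set of marked vertices, let $R=I-2\sum_{m\in\mathcal M}|d,m\rangle\langle d,m|$ and $U'=UR$, let $|\psi(0)\rangle$ be the uniform superposition of all $2N$ basis states, and let $$p(t)=\sum_{m\in\mathcal M}\bigl|\langle d,m|\,U'^{\,t}\,|\psi(0)\rangle\bigr|^2\qquad(t=0,1,2,\dots)$$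 be the success probability after $t$ steps. For positive constants $c,C,K$, call the configuration $(x,y)$ on the $n\times n$ torus *optimal* (with constants $c,C,K$) if there is a hitting time $t\le K\sqrt{N\log N}$, that is, a time maximising $p$ among all times $s\le K\sqrt{N\log N}$, with $p(t)\ge c/\log N$, and $p(s)\le C/\log N$ for all times $s\ge0$. (So the hitting time is $O(\sqrt{N\log N})$ and the success probability is $\Theta(1/\log N)$.) For integers $x,y$ let $\theta_k=2\pi k/n$ and let $$\mathcal I_n(x,y)=-\frac12\sum_{\substack{0\le k,l\le n-1\\ \cos\theta_k\cos\theta_l\ne1}}\cos\Bigl(2\pi\frac{kx+ly}{n}\Bigr)\frac{\sin\theta_k\sin\theta_l}{1-\cos\theta_k\cos\theta_l}$$ be the interference sum. Then there are absolute constants $c,C,K,D>0$ such that the following hold. 1. For all $n$ and all $0<x,y<n$, $\ |\mathcal I_n(x,y)|\le D\,\dfrac{n^2}{\min(x,n-x)\,\min(y,n-y)}$. 2. For all $n\ge1$ and all $0\le x,y<n$ with $\min(x,n-x)\cdot\min(y,n-y)\ge n$, the configuration $(x,y)$ is optimal with constants $c,C,K$. 3. For all $n\ge1$, the number of positions $(x,y)\ne(0,0)$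 of the second marked vertex that are not optimal with constants $c,C,K$ is at most $D\sqrt N\log N$. 4. Almost all two-element configurations are optimal: for every $\varepsilon>0$ there is $n_0$ such that for all $n\ge n_0$ at most $\varepsilon\,(N-1)$ of the $N-1$ positions $(x,y)\neq(0,0)$ are not optimal with constants $c,C,K$. -/

import Mathlib

open scoped Kronecker

noncomputable section

namespace QWSearch

/-- Vertices of the `n × n` torus. -/
abbrev Vertex (n : ℕ) : Type := ZMod n × ZMod n

/-- Labels `(v, (x, y))` of the computational basis `|v, x, y⟩`: a coin label and a vertex. -/
abbrev Basis (n : ℕ) : Type := Fin 2 × Vertex n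

/-- The coin `C_x`. -/
def coinX : Matrix (Fin 2) (Fin 2) ℂ :=
  ((Real.sqrt 2 : ℝ) : ℂ)⁻¹ • !![1, Complex.I; Complex.I, 1]

/-- The coin `C_y`. -/
def coinY : Matrix (Fin 2) (Fin 2) ℂ :=
  ((Real.sqrt 2 : ℝ) : ℂ)⁻¹ • !![1, -Complex.I; -Complex.I, 1]

/-- The conditional shift `Σ_x |v, x, y⟩ = |v, x - (-1)^v, y⟩`. -/
def shiftX (n : ℕ) : Matrix (Basis n) (Basis n) ℂ :=
  Matrix.of fun p q => if p = (q.1, (q.2.1 - (-1) ^ (q.1 : ℕ), q.2.2)) then 1 else 0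

/-- The conditional shift `Σ_y |v, x, y⟩ = |v, x, y - (-1)^v⟩`. -/
def shiftY (n : ℕ) : Matrix (Basis n) (Basis n) ℂ :=
  Matrix.of fun p q => if p = (q.1, (q.2.1, q.2.2 - (-1) ^ (q.1 : ℕ))) then 1 else 0

/-- The split-step walk operator `U = Σ_y (C_y ⊗ 1) Σ_x (C_x ⊗ 1)`. -/
def walk (n : ℕ) [NeZero n] : Matrix (Basis n) (Basis n) ℂ :=
  shiftY n * (coinY ⊗ₖ (1 : Matrix (Vertex n) (Vertex n) ℂ)) *
    (shiftX n * (coinX ⊗ₖ (1 : Matrix (Vertex n) (Vertex n) ℂ)))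

/-- The vector `|d, m⟩`, where `|d⟩ = (|0⟩ + |1⟩) / √2` is the diagonal coin state. -/
def diagAt (n : ℕ) (m : Vertex n) : Basis n → ℂ :=
  fun q => if q.2 = m then ((Real.sqrt 2 : ℝ) : ℂ)⁻¹ else 0

/-- The oracle `R = 1 - 2 ∑_{m ∈ M} |d, m⟩⟨d, m|`. -/
def oracle (n : ℕ) (M : Finset (Vertex n)) : Matrix (Basis n) (Basis n) ℂ :=
  1 - (2 : ℂ) • ∑ m ∈ M, Matrix.vecMulVec (diagAt n m) (star (diagAt n m))

/-- The perturbed evolution operator `U' = U R`. -/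
def searchStep (n : ℕ) [NeZero n] (M : Finset (Vertex n)) : Matrix (Basis n) (Basis n) ℂ :=
  walk n * oracle n M

/-- The initial state: the equal superposition of all `2 n²` basis states. -/
def initialState (n : ℕ) : Basis n → ℂ :=
  fun _ => ((Real.sqrt (2 * (n : ℝ) ^ 2) : ℝ) : ℂ)⁻¹

/-- The success probability `p(t) = ∑_{m ∈ M} |⟨d, m| U'^t |ψ(0)⟩|²` after `t` steps. -/
def successProb (n : ℕ) [NeZero n] (M : Finset (Vertex n)) (t : ℕ) : ℝ :=
  ∑ m ∈ M,
    ‖star (diagAt n m) ⬝ᵥ ((searchStep n M ^ t).mulVec (initialState n))‖ ^ 2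

/-- The two marked vertices `(0, 0)` and `(x, y)`. -/
def marked (n x y : ℕ) : Finset (Vertex n) :=
  {((0 : ZMod n), (0 : ZMod n)), ((x : ZMod n), (y : ZMod n))}

/-- The cyclic distance `min (x, n - x)` from `x` to `0`, for `0 ≤ x ≤ n`. -/
def cyc (n x : ℕ) : ℕ := min x (n - x)

/-- Optimality of the search for `(0, 0)` and `(x, y)`, with explicit constants, where `N = n²`:
within `K √(N log N)` steps there is a hitting time `t`, a time that maximises the success
probability over that period, at which the success probability is at least `c / log N`;
and the success probability never exceeds `C / log N`, at any time. -/
def IsOptimal (c C K : ℝ) (n : ℕ) [NeZero n] (x y : ℕ) : Prop :=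
  (∃ t : ℕ,
    (t : ℝ) ≤ K * Real.sqrt ((n : ℝ) ^ 2 * Real.log ((n : ℝ) ^ 2)) ∧
    (∀ s : ℕ, (s : ℝ) ≤ K * Real.sqrt ((n : ℝ) ^ 2 * Real.log ((n : ℝ) ^ 2)) →
      successProb n (marked n x y) s ≤ successProb n (marked n x y) t) ∧
    c / Real.log ((n : ℝ) ^ 2) ≤ successProb n (marked n x y) t) ∧
  ∀ s : ℕ, successProb n (marked n x y) s ≤ C / Real.log ((n : ℝ) ^ 2)

/-- The number of positions `(x, y) ≠ (0, 0)` of the second marked vertex for which the search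
is not optimal with the constants `c, C, K`. -/
def nonOptimalCount (c C K : ℝ) (n : ℕ) [NeZero n] : ℕ :=
  Set.ncard {p : ℕ × ℕ | p.1 < n ∧ p.2 < n ∧ p ≠ (0, 0) ∧ ¬ IsOptimal c C K n p.1 p.2}

/-- The angle `θ_k = 2πk / n`. -/
def angle (n k : ℕ) : ℝ := 2 * Real.pi * k / n

/-- The eigenphase `φ_{+,k,l} = arccos (cos θ_k cos θ_l)` of the walk operator. -/
def phase (n k l : ℕ) : ℝ := Real.arccos (Real.cos (angle n k) * Real.cos (angle n l))

open Classical in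
/-- The interference sum
`-1/2 ∑ cos (2π (k x + l y) / n) sin θ_k sin θ_l / (1 - cos θ_k cos θ_l)`
over the `(k, l)` in `{0, …, n - 1}²` with `φ_{+,k,l} ≠ 0`. -/
def interference (n x y : ℕ) : ℝ :=
  -(1 / 2) * ∑ q ∈ (Finset.range n ×ˢ Finset.range n).filter (fun q => phase n q.1 q.2 ≠ 0),
    Real.cos (2 * Real.pi * ((q.1 : ℝ) * x + (q.2 : ℝ) * y) / n) *
      (Real.sin (angle n q.1) * Real.sin (angle n q.2) /
        (1 - Real.cos (angle n q.1) * Real.cos (angle n q.2)))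

end QWSearch

end

/-! The walk maps plane waves to plane waves and acts on their coin part by a 2×2 matrix of
determinant 1 and trace 2 cos θ_k cos θ_l. The point reflection exchanging the marked vertices,
combined with the coin flip, respects the walk and fixes the uniform state. So the two marked
amplitudes stay equal, and the search is the walk perturbed by one reflection, in the unit vector w
= `markedVec`.

Write U for the walk, ψ_t for the state, a_t = ⟨w, ψ_t⟩, so that |a_0| = √2/n. Let β be the
plane-wave coefficients of w, c = cos θ_k cos θ_l, A the energy ∑ |β|²/(2 - 2c), q the vector with
coefficients β/(2 - 2c), and g = q - Uq. Then ‖g‖² = A and ⟨q, w⟩ = A, and two identities replace a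
spectral analysis of the perturbed operator.

Upper bound (`IsBlockFamily.overlap_le`): 2 A a_t = ⟨g, ψ_t⟩ - ⟨Uq, ψ_{t+1} - ψ_t⟩. The step length
is constantly 2|a_0|, so |a_t| = O(A^(-1/2)) at all times.

Lower bound (`IsBlockFamily.time_mul_overlap_le`): ⟨g, ψ_t⟩ grows by a_0 per step, up to errors
bounded by (2μT + μ + |b|) max |a_s|, where μ is the fixed weight and b the asymmetry. As |⟨g, ψ_T⟩|
≤ √A, the overlaps cannot all remain small up to a time T of order √A/|a_0|.

Here μ = O(1/n²) and b = -2 I/n², with I the interference sum. With X, Y the cyclic distances,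
`abs_interference_le` gives |I| = O(n²/(XY)), by summing over one frequency in closed form (a
conjugate Poisson kernel, decaying exponentially in the distance). So b = O(1/n) once XY ≥ n. In
that range A has order log n, by `greenSum_le` and, for large n, `le_greenSum`. Both bounds become
optimality, and a harmonic sum counts the pairs with XY < n. -/

open scoped Kronecker

noncomputable section

namespace QWSearch

/-! ### Abstract search: an isometry with two-dimensional blocks, perturbed by one reflection. -/

section RankOneSearch

variable {E ι : Type*} [NormedAddCommGroup E] [InnerProductSpace ℂ E] [Fintype ι]

/-- An orthonormal family `e` such that each `e i` spans together with `U (e i)` an invariant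
block of `U`, distinct blocks being orthogonal. -/
structure IsBlockFamily [DecidableEq ι] (U : E →ₗᵢ[ℂ] E) (e : ι → E) (c s : ι → ℝ) : Prop where
  orthonormal : Orthonormal ℂ e
  inner_map : ∀ i j, inner ℂ (e i) (U (e j)) = if i = j then (c i : ℂ) - s i * Complex.I else 0
  map_map : ∀ i, U (U (e i)) = (2 * c i : ℂ) • U (e i) - e i

variable [DecidableEq ι] {U : E →ₗᵢ[ℂ] E} {e : ι → E} {c s : ι → ℝ}

namespace IsBlockFamily

variable (h : IsBlockFamily U e c s)
include h

lemma inner_sum_map_sum (a b : ι → ℂ) :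
    inner ℂ (∑ i, a i • e i) (U (∑ i, b i • e i)) =
      ∑ i, (starRingEnd ℂ) (a i) * b i * ((c i : ℂ) - s i * Complex.I) := by
  simp only [map_sum, map_smul, sum_inner, inner_sum, inner_smul_left, inner_smul_right,
    h.inner_map]
  refine Finset.sum_congr rfl fun i _ => ?_
  simp only [mul_ite, mul_zero, Finset.sum_ite_eq', Finset.mem_univ, if_true]
  ring

lemma inner_sum_sum (a b : ι → ℂ) :
    inner ℂ (∑ i, a i • e i) (∑ i, b i • e i) = ∑ i, (starRingEnd ℂ) (a i) * b i :=
  h.orthonormal.inner_sum a b Finset.univ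

lemma norm_sq_sum (a : ι → ℂ) : ‖∑ i, a i • e i‖ ^ 2 = ∑ i, ‖a i‖ ^ 2 := by
  have := h.inner_sum_sum a a
  rw [inner_self_eq_norm_sq_to_K] at this
  have h2 : ((‖∑ i, a i • e i‖ ^ 2 : ℝ) : ℂ) = ((∑ i, ‖a i‖ ^ 2 : ℝ) : ℂ) := by
    push_cast
    rw [show ((‖∑ i, a i • e i‖ : ℝ) : ℂ) ^ 2 = _ from this]
    exact Finset.sum_congr rfl fun i _ => by rw [mul_comm, Complex.mul_conj']
  exact_mod_cast h2

-- Equality case of Cauchy–Schwarz: the inner product of two unit vectors has real part 1.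
omit [Fintype ι] in
lemma map_eq_self {i : ι} (hi : c i = 1) : U (e i) = e i := by
  have h1 : ‖e i‖ = 1 := h.orthonormal.norm_eq_one i
  have h2 : ‖U (e i) - e i‖ ^ 2 = 0 := by
    rw [norm_sub_sq (𝕜 := ℂ), U.norm_map, h1]
    have : RCLike.re (inner ℂ (U (e i)) (e i)) = 1 := by
      rw [inner_re_symm, h.inner_map]
      simp [hi]
    rw [this]; norm_num
  have h3 : ‖U (e i) - e i‖ = 0 := by simpa using h2
  exact sub_eq_zero.mp (norm_eq_zero.mp h3)

end IsBlockFamily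

/-- The resolvent-type vector `∑ β / (2 - 2 c) e`, the terms with `c = 1` being omitted. -/
def resolventVec (e : ι → E) (c : ι → ℝ) (β : ι → ℂ) : E :=
  ∑ i, (β i * ((2 - 2 * c i : ℝ) : ℂ)⁻¹) • e i

/-- The difference of the resolvent-type vector and its image. -/
def gradVec (U : E →ₗᵢ[ℂ] E) (e : ι → E) (c : ι → ℝ) (β : ι → ℂ) : E :=
  resolventVec e c β - U (resolventVec e c β)

/-- The projection of `∑ β e` to the fixed vectors of `U`. -/
def fixedVec (e : ι → E) (c : ι → ℝ) (β : ι → ℂ) : E :=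
  ∑ i, (if c i = 1 then β i else 0) • e i

/-- The energy `∑ |β|² / (2 - 2 c)`. -/
def energy (c : ι → ℝ) (β : ι → ℂ) : ℝ := ∑ i, ‖β i‖ ^ 2 * (2 - 2 * c i)⁻¹

/-- The squared norm of the fixed part. -/
def fixedWeight (c : ι → ℝ) (β : ι → ℂ) : ℝ := ∑ i, if c i = 1 then ‖β i‖ ^ 2 else 0

/-- The asymmetry `∑ |β|² s / (1 - c)`. -/
def asymmetry (c s : ι → ℝ) (β : ι → ℂ) : ℝ := ∑ i, ‖β i‖ ^ 2 * (s i / (1 - c i))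

lemma conj_mul_self_eq (z : ℂ) : (starRingEnd ℂ) z * z = ((‖z‖ ^ 2 : ℝ) : ℂ) := by
  rw [mul_comm, Complex.mul_conj']; push_cast; rfl

namespace IsBlockFamily

variable (h : IsBlockFamily U e c s) (β : ι → ℂ)
include h

lemma inner_resolventVec_sum :
    inner ℂ (resolventVec e c β) (∑ i, β i • e i) = (energy c β : ℂ) := by
  rw [resolventVec, h.inner_sum_sum, energy]
  push_cast
  refine Finset.sum_congr rfl fun i _ => ?_
  have := conj_mul_self_eq (β i)
  push_cast at this
  rw [← this]
  simp only [map_mul, map_inv₀, Complex.conj_ofReal, map_sub, map_ofNat]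
  ring

/-- Only the real part of the cross term enters, so the `s i` drop out and a mode with coefficient γ
contributes `|γ|² (2 - 2 c)`. -/
lemma norm_gradVec_sq : ‖gradVec U e c β‖ ^ 2 = energy c β := by
  have h1 : inner ℂ (resolventVec e c β) (U (resolventVec e c β)) =
      ∑ i, (starRingEnd ℂ) (β i * ((2 - 2 * c i : ℝ) : ℂ)⁻¹) * (β i * ((2 - 2 * c i : ℝ) : ℂ)⁻¹)
        * ((c i : ℂ) - s i * Complex.I) := h.inner_sum_map_sum _ _
  have h2 : ‖resolventVec e c β‖ ^ 2 = ∑ i, ‖β i * ((2 - 2 * c i : ℝ) : ℂ)⁻¹‖ ^ 2 :=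
    h.norm_sq_sum _
  have h3 : RCLike.re (inner ℂ (resolventVec e c β) (U (resolventVec e c β))) =
      ∑ i, ‖β i * ((2 - 2 * c i : ℝ) : ℂ)⁻¹‖ ^ 2 * c i := by
    rw [h1]
    simp only [conj_mul_self_eq]
    simp only [map_sum]
    refine Finset.sum_congr rfl fun i _ => ?_
    change (((_ : ℝ) : ℂ) * _).re = _
    rw [Complex.re_ofReal_mul]
    simp
  rw [gradVec, norm_sub_sq (𝕜 := ℂ), U.norm_map, h3, h2, energy, Finset.mul_sum,
    ← Finset.sum_sub_distrib, ← Finset.sum_add_distrib]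
  refine Finset.sum_congr rfl fun i _ => ?_
  rw [norm_mul, mul_pow, norm_inv, Complex.norm_real, Real.norm_eq_abs, inv_pow, sq_abs]
  by_cases hc : (2 - 2 * c i) = 0
  · simp [hc]
  · have hd : c i = 1 - (2 - 2 * c i) / 2 := by ring
    generalize 2 - 2 * c i = d at hc hd ⊢
    rw [hd]
    field_simp
    ring

lemma norm_resolventVec_sq_le {Γ : ℝ} (hc : ∀ i, c i ≤ 1) (hΓ : ∀ i, (2 - 2 * c i)⁻¹ ≤ Γ) :
    ‖resolventVec e c β‖ ^ 2 ≤ Γ * energy c β := by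
  rw [resolventVec, h.norm_sq_sum, energy, Finset.mul_sum]
  refine Finset.sum_le_sum fun i _ => ?_
  rw [norm_mul, mul_pow, norm_inv, Complex.norm_real, Real.norm_eq_abs]
  have h1 : 0 ≤ (2 - 2 * c i)⁻¹ := inv_nonneg.mpr (by linarith [hc i])
  rw [abs_of_nonneg (by linarith [hc i])]
  calc ‖β i‖ ^ 2 * (2 - 2 * c i)⁻¹ ^ 2
      = (2 - 2 * c i)⁻¹ * (‖β i‖ ^ 2 * (2 - 2 * c i)⁻¹) := by ring
    _ ≤ _ := mul_le_mul_of_nonneg_right (hΓ i) (by positivity)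

/-- In each block `(U - 1)(1 - U) = (2 - 2 c) U`, which cancels the resolvent weights. Modes with `c
= 1` have weight zero (inverse of zero), hence the correction by `fixedVec`. -/
lemma map_gradVec : U (gradVec U e c β) =
    gradVec U e c β + U (∑ i, β i • e i) - U (fixedVec e c β) := by
  simp only [gradVec, resolventVec, fixedVec, map_sub, map_sum, map_smul, h.map_map]
  rw [← Finset.sum_sub_distrib, ← Finset.sum_sub_distrib, ← Finset.sum_add_distrib,
    ← Finset.sum_sub_distrib]
  refine Finset.sum_congr rfl fun i _ => ?_
  by_cases hc : c i = 1
  · simp [hc]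
  · have h2 : ((2 - 2 * c i : ℝ) : ℂ) ≠ 0 := by
      exact_mod_cast fun h0 => hc (by linarith)
    simp only [hc, if_false]
    have h3 : β i = β i * ((2 - 2 * c i : ℝ) : ℂ)⁻¹ * (2 - 2 * c i) := by
      rw [show (2 - 2 * (c i : ℂ)) = ((2 - 2 * c i : ℝ) : ℂ) by push_cast; ring, mul_assoc,
        inv_mul_cancel₀ h2, mul_one]
    generalize hg : β i * ((2 - 2 * c i : ℝ) : ℂ)⁻¹ = γ at *
    rw [h3]
    module

lemma map_fixedVec : U (fixedVec e c β) = fixedVec e c β := by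
  simp only [fixedVec, map_sum, map_smul]
  refine Finset.sum_congr rfl fun i _ => ?_
  split_ifs with hc
  · rw [h.map_eq_self hc]
  · simp

lemma inner_fixedVec_sum :
    inner ℂ (fixedVec e c β) (∑ i, β i • e i) = (fixedWeight c β : ℂ) := by
  rw [fixedVec, h.inner_sum_sum, fixedWeight]
  push_cast
  refine Finset.sum_congr rfl fun i _ => ?_
  have := conj_mul_self_eq (β i)
  push_cast at this
  split_ifs <;> simp [this]

/-- The reflection shifts the pairing with `gradVec` by a multiple of this number. The leading 1
cancels against the sign-flipped overlap coming from `inner_gradVec_map`, leaving only the fixed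
weight and the asymmetry as errors. -/
lemma inner_gradVec_sum (hβ : ∑ i, ‖β i‖ ^ 2 = 1) :
    2 * inner ℂ (gradVec U e c β) (∑ i, β i • e i) =
      1 - (fixedWeight c β : ℂ) - asymmetry c s β * Complex.I := by
  have h1 : inner ℂ (U (resolventVec e c β)) (∑ i, β i • e i) =
      ∑ i, (starRingEnd ℂ) ((starRingEnd ℂ) (β i) * (β i * ((2 - 2 * c i : ℝ) : ℂ)⁻¹)
        * ((c i : ℂ) - s i * Complex.I)) := by
    rw [← inner_conj_symm, resolventVec, h.inner_sum_map_sum, map_sum]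
  have hβ' : (1 : ℂ) = ∑ i, ((‖β i‖ ^ 2 : ℝ) : ℂ) := by rw [← Complex.ofReal_sum, hβ]; simp
  rw [gradVec, inner_sub_left, h1, h.inner_resolventVec_sum, hβ', energy, fixedWeight, asymmetry,
    Complex.ofReal_sum, Complex.ofReal_sum, Complex.ofReal_sum, ← Finset.sum_sub_distrib,
    Finset.sum_mul, ← Finset.sum_sub_distrib, ← Finset.sum_sub_distrib, Finset.mul_sum]
  refine Finset.sum_congr rfl fun i _ => ?_
  simp only [map_mul, map_inv₀, Complex.conj_ofReal, map_sub, Complex.conj_I, Complex.conj_conj]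
  have := conj_mul_self_eq (β i)
  rw [show β i * ((starRingEnd ℂ) (β i) * ((2 - 2 * c i : ℝ) : ℂ)⁻¹) =
    ((starRingEnd ℂ) (β i) * β i) * ((2 - 2 * c i : ℝ) : ℂ)⁻¹ by ring, this]
  generalize ‖β i‖ ^ 2 = B
  by_cases hc : c i = 1
  · simp [hc]
  · have h2 : ((1 : ℂ) - c i) ≠ 0 := by
      exact_mod_cast fun h0 => hc (by linarith)
    have h3 : ((2 : ℂ) - 2 * c i) ≠ 0 := by
      rw [show (2 : ℂ) - 2 * c i = 2 * (1 - c i) by ring]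
      simpa using h2
    simp only [hc, if_false]
    push_cast
    field_simp
    ring

lemma inner_gradVec_map (x : E) : inner ℂ (gradVec U e c β) (U x) =
    inner ℂ (gradVec U e c β) x - inner ℂ (∑ i, β i • e i) x + inner ℂ (fixedVec e c β) x := by
  have h1 : gradVec U e c β =
      U (gradVec U e c β - ∑ i, β i • e i + fixedVec e c β) := by
    rw [map_add, map_sub, h.map_gradVec]; abel
  conv_lhs => rw [h1]
  rw [U.inner_map_map, inner_add_left, inner_sub_left]

end IsBlockFamily

/-- `R = 1 - 2 |w⟩⟨w|` preserves the norm. -/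
lemma norm_sub_two_smul {w : E} (hw : ‖w‖ = 1) (x : E) :
    ‖x - (2 * inner ℂ w x) • w‖ = ‖x‖ := by
  have h1 : ‖x - (2 * inner ℂ w x) • w‖ ^ 2 = ‖x‖ ^ 2 := by
    rw [norm_sub_sq (𝕜 := ℂ), norm_smul, hw, inner_smul_right, ← inner_conj_symm x w, mul_assoc,
      Complex.mul_conj']
    have : RCLike.re ((2 : ℂ) * (‖inner ℂ w x‖ : ℂ) ^ 2) = 2 * ‖inner ℂ w x‖ ^ 2 := by
      change ((2 : ℂ) * (‖inner ℂ w x‖ : ℂ) ^ 2).re = _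
      rw [← Complex.ofReal_pow, ← Complex.ofReal_ofNat, ← Complex.ofReal_mul, Complex.ofReal_re]
    rw [this]
    simp
    ring
  exact (sq_eq_sq₀ (norm_nonneg _) (norm_nonneg _)).mp h1

section Dynamics

variable {w : E} {ψ : ℕ → E} (hw : ‖w‖ = 1)
  (hψ : ∀ t, ψ (t + 1) = U (ψ t - (2 * inner ℂ w (ψ t)) • w))
include hw hψ

lemma norm_orbit (t : ℕ) : ‖ψ t‖ = ‖ψ 0‖ := by
  induction t with
  | zero => rfl
  | succ t ih => rw [hψ, U.norm_map, norm_sub_two_smul hw, ih]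

/-- One linear isometry advances both states, hence also their difference. -/
lemma norm_orbit_sub (t : ℕ) : ‖ψ (t + 1) - ψ t‖ = ‖ψ 1 - ψ 0‖ := by
  induction t with
  | zero => rfl
  | succ t ih =>
    rw [← ih, ← norm_sub_two_smul hw (ψ (t + 1) - ψ t), ← U.norm_map (_ - _ • w), hψ (t + 1)]
    congr 1
    conv_lhs => rw [hψ t]
    rw [← map_sub, ← hψ t]
    congr 1
    rw [inner_sub_right, mul_sub, sub_smul]
    abel

lemma norm_orbit_one_sub (h0 : U (ψ 0) = ψ 0) : ‖ψ 1 - ψ 0‖ = 2 * ‖inner ℂ w (ψ 0)‖ := by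
  have : ψ 1 - ψ 0 = U (-((2 * inner ℂ w (ψ 0)) • w)) := by
    rw [hψ 0, map_sub, h0, map_neg]
    abel
  rw [this, U.norm_map, norm_neg, norm_smul, hw]
  simp

end Dynamics

namespace IsBlockFamily

variable (h : IsBlockFamily U e c s) {β : ι → ℂ} {ψ : ℕ → E}
  (hw : ‖∑ i, β i • e i‖ = 1) (h0 : U (ψ 0) = ψ 0) (h1 : ‖ψ 0‖ = 1)
  (hψ : ∀ t, ψ (t + 1) = U (ψ t - (2 * inner ℂ (∑ i, β i • e i) (ψ t)) • ∑ i, β i • e i))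
include h hw h0 h1 hψ

/-- The overlap with the marked vector is at most of the order of `energy ^ (-1/2)`. -/
theorem overlap_le {Γ : ℝ} (hc : ∀ i, c i ≤ 1) (hΓ : ∀ i, (2 - 2 * c i)⁻¹ ≤ Γ) (hΓ0 : 0 ≤ Γ)
    (t : ℕ) : 2 * Real.sqrt (energy c β) * ‖inner ℂ (∑ i, β i • e i) (ψ t)‖ ≤
      1 + 2 * ‖inner ℂ (∑ i, β i • e i) (ψ 0)‖ * Real.sqrt Γ := by
  set w := ∑ i, β i • e i
  set A := energy c β
  set a := inner ℂ w (ψ t)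
  have hA : 0 ≤ A := by
    rw [show A = _ from (h.norm_gradVec_sq β).symm]; positivity
  have hg : ‖gradVec U e c β‖ = Real.sqrt A := by
    rw [← show _ = A from h.norm_gradVec_sq β, Real.sqrt_sq (norm_nonneg _)]
  have hq : ‖U (resolventVec e c β)‖ ≤ Real.sqrt Γ * Real.sqrt A := by
    rw [U.norm_map, ← Real.sqrt_mul hΓ0]
    exact Real.le_sqrt_of_sq_le (h.norm_resolventVec_sq_le β hc hΓ)
  -- Write q for the resolvent vector. Cancelling `U` in `⟨U q, ψ (t + 1)⟩` leaves `⟨q, ψ t⟩ - 2 a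
  -- A`, because `⟨q, w⟩ = A`.
  have key : 2 * a * A = inner ℂ (gradVec U e c β) (ψ t) -
      inner ℂ (U (resolventVec e c β)) (ψ (t + 1) - ψ t) := by
    rw [inner_sub_right, hψ t, U.inner_map_map, inner_sub_right, inner_smul_right,
      h.inner_resolventVec_sum, gradVec, inner_sub_left]
    ring
  have hk : 2 * ‖a‖ * A ≤ Real.sqrt A + Real.sqrt Γ * Real.sqrt A * (2 * ‖inner ℂ w (ψ 0)‖) := by
    have e1 : ‖2 * a * A‖ = 2 * ‖a‖ * A := by
      simp [abs_of_nonneg hA]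
    rw [← e1, key]
    refine (norm_sub_le _ _).trans (add_le_add ?_ ?_)
    · refine (norm_inner_le_norm _ _).trans ?_
      rw [norm_orbit hw hψ, h1, hg, mul_one]
    · refine (norm_inner_le_norm _ _).trans ?_
      rw [norm_orbit_sub hw hψ, norm_orbit_one_sub hw hψ h0]
      exact mul_le_mul_of_nonneg_right hq (by positivity)
  rcases hA.eq_or_lt with hA0 | hA0
  · rw [← hA0]
    simp only [Real.sqrt_zero, mul_zero, zero_mul]
    positivity
  · have hs : 0 < Real.sqrt A := Real.sqrt_pos.mpr hA0
    have hss : Real.sqrt A * Real.sqrt A = A := Real.mul_self_sqrt hA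
    refine le_of_mul_le_mul_right ?_ hs
    calc 2 * Real.sqrt A * ‖a‖ * Real.sqrt A = 2 * ‖a‖ * (Real.sqrt A * Real.sqrt A) := by ring
      _ = 2 * ‖a‖ * A := by rw [hss]
      _ ≤ _ := hk
      _ = _ := by ring

/-- If the overlap with the marked vector stays small up to time `T`, then `T` is not too large. -/
theorem time_mul_overlap_le {η : ℝ} (T : ℕ)
    (hη : ∀ t < T, ‖inner ℂ (∑ i, β i • e i) (ψ t)‖ ≤ η) :
    T * ‖inner ℂ (∑ i, β i • e i) (ψ 0)‖ ≤ Real.sqrt (energy c β) +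
      T * (2 * fixedWeight c β * T * η + (fixedWeight c β + |asymmetry c s β|) * η) := by
  set w := ∑ i, β i • e i with hwdef
  set μ := fixedWeight c β
  set b := asymmetry c s β
  set g := gradVec U e c β
  set p := fixedVec e c β
  set a : ℕ → ℂ := fun t => inner ℂ w (ψ t)
  have hμ : 0 ≤ μ := Finset.sum_nonneg fun i _ => by split_ifs <;> positivity
  have hβ : ∑ i, ‖β i‖ ^ 2 = 1 := by rw [← h.norm_sq_sum, ← hwdef, hw]; norm_num
  have hg : ‖g‖ = Real.sqrt (energy c β) := by
    rw [← h.norm_gradVec_sq, Real.sqrt_sq (norm_nonneg _)]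
  have hp0 : inner ℂ p (ψ 0) = a 0 := by
    have := h.inner_gradVec_map β (ψ 0)
    rw [h0] at this
    linear_combination -this
  have hg0 : inner ℂ g (ψ 0) = 0 := by
    change inner ℂ (_ - _) _ = _
    rw [inner_sub_left]
    nth_rewrite 2 [← h0]
    rw [U.inner_map_map, sub_self]
  have hww : inner ℂ w w = (1 : ℂ) := by
    rw [inner_self_eq_norm_sq_to_K, hw]; simp
  -- The walk does not move the fixed component; only the reflection changes it, at the slow rate
  -- `μ`.
  have hp : ∀ t, inner ℂ p (ψ (t + 1)) = inner ℂ p (ψ t) - 2 * μ * a t := by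
    intro t
    have : p = U p := (h.map_fixedVec β).symm
    rw [this, hψ t, U.inner_map_map, ← this, inner_sub_right, inner_smul_right,
      h.inner_fixedVec_sum]
    change _ - 2 * a t * μ = _
    ring
  -- The drift equation: `⟨p, ψ t⟩` stays near `a 0`, so the pairing with `g` grows linearly while
  -- the overlaps are small.
  have hG : ∀ t, inner ℂ g (ψ (t + 1)) =
      inner ℂ g (ψ t) + inner ℂ p (ψ t) + (b * Complex.I - μ) * a t := by
    intro t
    rw [hψ t, h.inner_gradVec_map]
    simp only [inner_sub_right, inner_smul_right]
    have e1 := h.inner_gradVec_sum β hβ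
    have e2 := h.inner_fixedVec_sum β
    rw [← hwdef] at e1 e2
    change 2 * inner ℂ g w = 1 - (μ : ℂ) - b * Complex.I at e1
    change inner ℂ p w = (μ : ℂ) at e2
    rw [← hwdef, hww, e2]
    change _ - 2 * a t * _ - (a t - 2 * a t * 1) + (_ - 2 * a t * μ) = _
    linear_combination (-a t) * e1
  have hη0 : ∀ t < T, 0 ≤ η := fun t ht => (norm_nonneg _).trans (hη t ht)
  have hpt : ∀ t ≤ T, ‖inner ℂ p (ψ t) - a 0‖ ≤ 2 * μ * t * η := by
    intro t
    induction t with
    | zero => intro _; simp [hp0]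
    | succ t ih =>
      intro ht
      have e1 := ih (by omega)
      have e2 := hη t (by omega)
      have e3 : inner ℂ p (ψ (t + 1)) - a 0 = (inner ℂ p (ψ t) - a 0) - 2 * μ * a t := by
        rw [hp]; ring
      rw [e3]
      refine (norm_sub_le _ _).trans ?_
      have e4 : ‖2 * (μ : ℂ) * a t‖ = 2 * μ * ‖a t‖ := by simp [abs_of_nonneg hμ]
      rw [e4]
      push_cast
      have e5 : 2 * μ * ‖a t‖ ≤ 2 * μ * η := mul_le_mul_of_nonneg_left e2 (by positivity)
      linarith
  have hGt : ∀ t ≤ T, ‖inner ℂ g (ψ t) - t * a 0‖ ≤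
      t * (2 * μ * T * η + (μ + |b|) * η) := by
    intro t
    induction t with
    | zero => intro _; simp [hg0]
    | succ t ih =>
      intro ht
      have e1 := ih (by omega)
      have e2 := hη t (by omega)
      have e6 := hpt t (by omega)
      have e3 : inner ℂ g (ψ (t + 1)) - ((t + 1 : ℕ) : ℂ) * a 0 =
          (inner ℂ g (ψ t) - t * a 0) + (inner ℂ p (ψ t) - a 0) + (b * Complex.I - μ) * a t := by
        rw [hG]; push_cast; ring
      rw [e3]
      refine (norm_add₃_le).trans ?_
      have e4 : ‖((b : ℂ) * Complex.I - μ) * a t‖ ≤ (μ + |b|) * η := by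
        rw [norm_mul]
        refine mul_le_mul ?_ e2 (norm_nonneg _) (by positivity)
        refine (norm_sub_le _ _).trans ?_
        simp [abs_of_nonneg hμ, add_comm]
      have e7 : 2 * μ * t * η ≤ 2 * μ * T * η := by
        refine mul_le_mul_of_nonneg_right ?_ (hη0 t (by omega))
        refine mul_le_mul_of_nonneg_left ?_ (by positivity)
        exact_mod_cast (by omega : t ≤ T)
      push_cast
      linarith
  have e8 := hGt T le_rfl
  have e9 : ‖(T : ℂ) * a 0‖ = T * ‖a 0‖ := by simp
  -- Cauchy–Schwarz caps the linear growth.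
  have e10 : ‖inner ℂ g (ψ T)‖ ≤ Real.sqrt (energy c β) := by
    refine (norm_inner_le_norm _ _).trans ?_
    rw [norm_orbit hw hψ, h1, hg, mul_one]
  have e11 : ‖(T : ℂ) * a 0‖ ≤ ‖inner ℂ g (ψ T)‖ + ‖inner ℂ g (ψ T) - T * a 0‖ := by
    rw [norm_sub_rev]
    have := norm_add_le (inner ℂ g (ψ T)) (T * a 0 - inner ℂ g (ψ T))
    rwa [add_sub_cancel] at this
  rw [e9] at e11
  linarith

end IsBlockFamily

end RankOneSearch

/-! ### Plane waves and the spectral blocks of the walk. -/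

section Walk

open Matrix

variable {n : ℕ} [NeZero n]

lemma shiftX_mulVec (ψ : Basis n → ℂ) (v : Fin 2) (x y : ZMod n) :
    (shiftX n *ᵥ ψ) (v, (x, y)) = ψ (v, (x + (-1) ^ (v : ℕ), y)) := by
  rw [mulVec, dotProduct, Finset.sum_eq_single (v, (x + (-1) ^ (v : ℕ), y))]
  · simp [shiftX]
  · rintro ⟨v', x', y'⟩ - hne
    rw [shiftX, of_apply, if_neg, zero_mul]
    intro h
    apply hne
    simp only [Prod.mk.injEq] at h ⊢
    obtain ⟨rfl, rfl, rfl⟩ := h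
    simp
  · simp

lemma shiftY_mulVec (ψ : Basis n → ℂ) (v : Fin 2) (x y : ZMod n) :
    (shiftY n *ᵥ ψ) (v, (x, y)) = ψ (v, (x, y + (-1) ^ (v : ℕ))) := by
  rw [mulVec, dotProduct, Finset.sum_eq_single (v, (x, y + (-1) ^ (v : ℕ)))]
  · simp [shiftY]
  · rintro ⟨v', x', y'⟩ - hne
    rw [shiftY, of_apply, if_neg, zero_mul]
    intro h
    apply hne
    simp only [Prod.mk.injEq] at h ⊢
    obtain ⟨rfl, rfl, rfl⟩ := h
    simp
  · simp

lemma kronecker_one_mulVec (C : Matrix (Fin 2) (Fin 2) ℂ) (ψ : Basis n → ℂ) (v : Fin 2)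
    (r : Vertex n) :
    ((C ⊗ₖ (1 : Matrix (Vertex n) (Vertex n) ℂ)) *ᵥ ψ) (v, r) = ∑ v', C v v' * ψ (v', r) := by
  rw [mulVec, dotProduct, Fintype.sum_prod_type]
  refine Finset.sum_congr rfl fun v' _ => ?_
  simp [kroneckerMap_apply, one_apply]

lemma walk_mulVec (ψ : Basis n → ℂ) (v : Fin 2) (x y : ZMod n) :
    (walk n *ᵥ ψ) (v, (x, y)) = ∑ v', coinY v v' *
      ∑ v'', coinX v' v'' * ψ (v'', (x + (-1) ^ (v' : ℕ), y + (-1) ^ (v : ℕ))) := by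
  simp only [walk, ← mulVec_mulVec, shiftY_mulVec, kronecker_one_mulVec, shiftX_mulVec]

lemma shiftX_unitary : (shiftX n)ᴴ * shiftX n = 1 := by
  ext ⟨v, x, y⟩ ⟨v', x', y'⟩
  rw [mul_apply, Finset.sum_eq_single (v, (x - (-1) ^ (v : ℕ), y))]
  · simp only [shiftX, conjTranspose_apply, of_apply, one_apply, Prod.mk.injEq, if_true,
      star_one, one_mul]
    by_cases h : v = v'
    · subst h; simp
    · simp [h]
  · intro p _ hp
    simp [shiftX, hp]
  · simp

lemma shiftY_unitary : (shiftY n)ᴴ * shiftY n = 1 := by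
  ext ⟨v, x, y⟩ ⟨v', x', y'⟩
  rw [mul_apply, Finset.sum_eq_single (v, (x, y - (-1) ^ (v : ℕ)))]
  · simp only [shiftY, conjTranspose_apply, of_apply, one_apply, Prod.mk.injEq, if_true,
      star_one, one_mul]
    by_cases h : v = v'
    · subst h; simp
    · simp [h]
  · intro p _ hp
    simp [shiftY, hp]
  · simp

lemma inv_sqrt_two_mul_self :
    ((Real.sqrt 2 : ℝ) : ℂ)⁻¹ * ((Real.sqrt 2 : ℝ) : ℂ)⁻¹ = 1 / 2 := by
  rw [← mul_inv, ← Complex.ofReal_mul, Real.mul_self_sqrt (by norm_num)]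
  norm_num

lemma coinX_unitary : coinXᴴ * coinX = 1 := by
  have h := inv_sqrt_two_mul_self
  rw [coinX, conjTranspose_smul, Matrix.smul_mul, Matrix.mul_smul, smul_smul]
  rw [show star ((Real.sqrt 2 : ℝ) : ℂ)⁻¹ = ((Real.sqrt 2 : ℝ) : ℂ)⁻¹ by
    rw [star_inv₀]; congr 1; exact Complex.conj_ofReal _, h]
  ext i j
  fin_cases i <;> fin_cases j <;> simp [mul_apply, Fin.sum_univ_two] <;> norm_num

lemma coinY_unitary : coinYᴴ * coinY = 1 := by
  have h := inv_sqrt_two_mul_self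
  rw [coinY, conjTranspose_smul, Matrix.smul_mul, Matrix.mul_smul, smul_smul]
  rw [show star ((Real.sqrt 2 : ℝ) : ℂ)⁻¹ = ((Real.sqrt 2 : ℝ) : ℂ)⁻¹ by
    rw [star_inv₀]; congr 1; exact Complex.conj_ofReal _, h]
  ext i j
  fin_cases i <;> fin_cases j <;> simp [mul_apply, Fin.sum_univ_two] <;> norm_num

lemma kronecker_one_unitary {C : Matrix (Fin 2) (Fin 2) ℂ} (hC : Cᴴ * C = 1) :
    (C ⊗ₖ (1 : Matrix (Vertex n) (Vertex n) ℂ))ᴴ * (C ⊗ₖ (1 : Matrix (Vertex n) (Vertex n) ℂ))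
      = 1 := by
  rw [conjTranspose_kronecker, ← mul_kronecker_mul, hC, conjTranspose_one, one_mul,
    one_kronecker_one]

lemma conjTranspose_mul_self_mul {m : Type*} [Fintype m] [DecidableEq m] {A B : Matrix m m ℂ}
    (hA : Aᴴ * A = 1) (hB : Bᴴ * B = 1) : (A * B)ᴴ * (A * B) = 1 := by
  rw [conjTranspose_mul, Matrix.mul_assoc, ← Matrix.mul_assoc Aᴴ, hA, one_mul, hB]

lemma walk_unitary : (walk n)ᴴ * walk n = 1 :=
  conjTranspose_mul_self_mul
    (conjTranspose_mul_self_mul shiftY_unitary (kronecker_one_unitary coinY_unitary))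
    (conjTranspose_mul_self_mul shiftX_unitary (kronecker_one_unitary coinX_unitary))

/-- The walk operator as a linear isometry. -/
def walkIso (n : ℕ) [NeZero n] : EuclideanSpace ℂ (Basis n) →ₗᵢ[ℂ] EuclideanSpace ℂ (Basis n) :=
  (toEuclideanLin (walk n)).isometryOfInner fun x y => by
    rw [EuclideanSpace.inner_eq_star_dotProduct, EuclideanSpace.inner_eq_star_dotProduct,
      ofLp_toLpLin, ofLp_toLpLin, toLin'_apply, toLin'_apply, star_mulVec, dotProduct_comm,
      ← dotProduct_mulVec, mulVec_mulVec, walk_unitary, one_mulVec, dotProduct_comm]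

lemma walkIso_toLp (ψ : Basis n → ℂ) :
    walkIso n (WithLp.toLp 2 ψ) = WithLp.toLp 2 (walk n *ᵥ ψ) := rfl

/-- The plane wave `u ⊗ χ_k`. -/
def planeWave (u : Fin 2 → ℂ) (k : Vertex n) : Basis n → ℂ :=
  fun q => u q.1 * (ZMod.stdAddChar (k.1 * q.2.1) * ZMod.stdAddChar (k.2 * q.2.2))

/-- `cos (2 π k / n)` as a function on `ZMod n`. -/
def zcos (k : ZMod n) : ℝ := (ZMod.stdAddChar k : ℂ).re

/-- `sin (2 π k / n)` as a function on `ZMod n`. -/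
def zsin (k : ZMod n) : ℝ := (ZMod.stdAddChar k : ℂ).im

lemma stdAddChar_eq (k : ZMod n) : (ZMod.stdAddChar k : ℂ) = zcos k + zsin k * Complex.I :=
  (Complex.re_add_im _).symm

lemma stdAddChar_neg_eq (k : ZMod n) :
    (ZMod.stdAddChar (-k) : ℂ) = zcos k - zsin k * Complex.I := by
  rw [AddChar.map_neg_eq_conj, stdAddChar_eq]
  simp [sub_eq_add_neg]

lemma zcos_sq_add_zsin_sq (k : ZMod n) : zcos k ^ 2 + zsin k ^ 2 = 1 := by
  have : ‖(ZMod.stdAddChar k : ℂ)‖ ^ 2 = 1 := by rw [AddChar.norm_apply]; norm_num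
  rw [Complex.sq_norm, Complex.normSq_apply] at this
  rw [zcos, zsin]; linarith

/-- The action of the walk on the coin part of a plane wave. -/
def coinBlock (k : Vertex n) (u : Fin 2 → ℂ) : Fin 2 → ℂ :=
  ![ZMod.stdAddChar k.2 * (zcos k.1 * u 0 - zsin k.1 * u 1),
    ZMod.stdAddChar (-k.2) * (zsin k.1 * u 0 + zcos k.1 * u 1)]

/-- The coins are mutually inverse and conjugate the diagonal phases of the x-shift into a real
rotation; the y-shift then adds its own phases. -/
lemma walk_mulVec_planeWave (u : Fin 2 → ℂ) (k : Vertex n) :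
    walk n *ᵥ planeWave u k = planeWave (coinBlock k u) k := by
  ext ⟨v, x, y⟩
  rw [walk_mulVec]
  have h := inv_sqrt_two_mul_self
  have hI := Complex.I_sq
  obtain ⟨k, l⟩ := k
  have e1 : ∀ m : ZMod n, m * (-1) = -m := fun m => by ring
  have e2 := stdAddChar_eq k
  have e3 := stdAddChar_neg_eq k
  generalize hσ : ((Real.sqrt 2 : ℝ) : ℂ)⁻¹ = σ at h
  fin_cases v <;>
    simp only [Fin.sum_univ_two, planeWave, coinX, coinY, coinBlock, Fin.zero_eta, Fin.mk_one,
      Fin.isValue, Fin.val_zero, Fin.val_one, pow_zero, pow_one, mul_add, AddChar.map_add_eq_mul,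
      mul_one, Matrix.smul_apply, smul_eq_mul, of_apply, cons_val', cons_val_zero, cons_val_one,
      cons_val_fin_one, hσ, e1]
  · rw [e2, e3]
    generalize (ZMod.stdAddChar l : ℂ) = w
    generalize (ZMod.stdAddChar (l * y) : ℂ) = w'
    generalize (ZMod.stdAddChar (k * x) : ℂ) = w''
    linear_combination (w * w' * w'' * 2 * (zcos k * u 0 - zsin k * u 1)) * h +
      σ ^ 2 * w * w' * w'' * (-u 0 * zcos k + u 0 * zsin k * Complex.I + 2 * zsin k * u 1) * hI
  · rw [e2, e3]
    generalize (ZMod.stdAddChar (-l) : ℂ) = w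
    generalize (ZMod.stdAddChar (l * y) : ℂ) = w'
    generalize (ZMod.stdAddChar (k * x) : ℂ) = w''
    linear_combination (w * w' * w'' * 2 * (zsin k * u 0 + zcos k * u 1)) * h -
      σ ^ 2 * w * w' * w'' * (u 1 * zsin k * Complex.I + 2 * u 0 * zsin k + zcos k * u 1) * hI

lemma sum_stdAddChar_mul (k : ZMod n) :
    ∑ x : ZMod n, (ZMod.stdAddChar (k * x) : ℂ) = if k = 0 then (n : ℂ) else 0 := by
  have := AddChar.sum_mulShift k (ZMod.isPrimitive_stdAddChar n)
  simp only [mul_comm _ k, ZMod.card] at this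
  rw [this]; split_ifs <;> simp

lemma inner_planeWave (u u' : Fin 2 → ℂ) (k k' : Vertex n) :
    inner ℂ (WithLp.toLp 2 (planeWave u k)) (WithLp.toLp 2 (planeWave u' k')) =
      if k = k' then (n : ℂ) ^ 2 * ∑ v, (starRingEnd ℂ) (u v) * u' v else 0 := by
  have h1 : ∀ q : Basis n, planeWave u' k' q * star (planeWave u k q) =
      ((starRingEnd ℂ) (u q.1) * u' q.1) * (ZMod.stdAddChar ((k'.1 - k.1) * q.2.1) *
        ZMod.stdAddChar ((k'.2 - k.2) * q.2.2)) := by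
    intro q
    change _ * (starRingEnd ℂ) _ = _
    simp only [planeWave, map_mul, ← AddChar.map_neg_eq_conj, sub_eq_add_neg, add_mul,
      AddChar.map_add_eq_mul, neg_mul]
    ring
  rw [EuclideanSpace.inner_toLp_toLp, dotProduct]
  simp only [Pi.star_apply, h1]
  rw [Fintype.sum_prod_type]
  simp only [Fintype.sum_prod_type, ← Finset.mul_sum, ← Finset.sum_mul, sum_stdAddChar_mul,
    sub_eq_zero]
  obtain ⟨k1, k2⟩ := k
  obtain ⟨k1', k2'⟩ := k'
  simp only [Prod.mk.injEq, eq_comm (a := k1), eq_comm (a := k2)]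
  by_cases ha : k1' = k1 <;> by_cases hb : k2' = k2 <;> simp [ha, hb]
  ring

/-- The normalised plane waves with the diagonal coin state. -/
def diagWave (k : Vertex n) : EuclideanSpace ℂ (Basis n) :=
  WithLp.toLp 2 (planeWave (fun _ => ((Real.sqrt 2 : ℝ) : ℂ)⁻¹ * (n : ℂ)⁻¹) k)

lemma planeWave_smul_sub (a : ℂ) (u u' : Fin 2 → ℂ) (k : Vertex n) :
    planeWave (a • u - u') k = a • planeWave u k - planeWave u' k := by
  ext q
  simp [planeWave]
  ring

/-- The coin block has determinant 1 and trace `2 cos θ_k cos θ_l`, so the quadratic relation is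
Cayley–Hamilton. The diagonal entry at `|d⟩` gives `c - i s`. -/
lemma diagWave_isBlockFamily :
    IsBlockFamily (walkIso n) (diagWave (n := n)) (fun k => zcos k.1 * zcos k.2)
      (fun k => zsin k.1 * zsin k.2) := by
  have hn : (n : ℂ) ≠ 0 := Nat.cast_ne_zero.mpr (NeZero.ne n)
  have h := inv_sqrt_two_mul_self
  refine ⟨?_, ?_, ?_⟩
  · rw [orthonormal_iff_ite]
    intro i j
    rw [diagWave, diagWave, inner_planeWave]
    split_ifs
    · simp only [map_mul, map_inv₀, Complex.conj_ofReal, map_natCast, Fin.sum_univ_two]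
      field_simp
      norm_num [← Complex.ofReal_pow]
    · rfl
  · intro i j
    rw [diagWave, diagWave, walkIso_toLp, walk_mulVec_planeWave, inner_planeWave]
    split_ifs with hij
    · subst hij
      simp only [map_mul, map_inv₀, Complex.conj_ofReal, map_natCast, Fin.sum_univ_two, coinBlock,
        stdAddChar_neg_eq, cons_val_zero, cons_val_one]
      rw [stdAddChar_eq]
      generalize ((Real.sqrt 2 : ℝ) : ℂ)⁻¹ = σ at h ⊢
      have hn2 : (n : ℂ) * (n : ℂ)⁻¹ = 1 := mul_inv_cancel₀ hn
      generalize (n : ℂ)⁻¹ = m at hn2 ⊢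
      push_cast
      linear_combination ((n : ℂ) * m) ^ 2 * (2 * (zcos i.1 * zcos i.2 -
        zsin i.1 * zsin i.2 * Complex.I)) * h + ((n : ℂ) * m + 1) * (zcos i.1 * zcos i.2 -
        zsin i.1 * zsin i.2 * Complex.I) * hn2
    · rfl
  · intro k
    have hU : ∀ u, walkIso n (WithLp.toLp 2 (planeWave u k)) =
        WithLp.toLp 2 (planeWave (coinBlock k u) k) := fun u => by
      rw [walkIso_toLp, walk_mulVec_planeWave]
    rw [diagWave, hU, hU, ← WithLp.toLp_smul, ← WithLp.toLp_sub, ← planeWave_smul_sub]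
    congr 2
    have h1 : (zcos k.1 : ℂ) ^ 2 + (zsin k.1 : ℂ) ^ 2 = 1 := by
      exact_mod_cast zcos_sq_add_zsin_sq k.1
    have h2 : (zcos k.2 : ℂ) ^ 2 + (zsin k.2 : ℂ) ^ 2 = 1 := by
      exact_mod_cast zcos_sq_add_zsin_sq k.2
    generalize ((Real.sqrt 2 : ℝ) : ℂ)⁻¹ * (n : ℂ)⁻¹ = m
    have hI := Complex.I_sq
    ext v
    fin_cases v <;>
      simp only [coinBlock, stdAddChar_neg_eq, Fin.zero_eta, Fin.mk_one, Fin.isValue,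
        cons_val_zero, cons_val_one, cons_val_fin_one, Pi.sub_apply, Pi.smul_apply, smul_eq_mul,
        Complex.ofReal_mul] <;>
      rw [stdAddChar_eq] <;>
      linear_combination ((zcos k.1 : ℂ) ^ 2 + (zsin k.1 : ℂ) ^ 2) * m * (zsin k.2 : ℂ) ^ 2 * hI -
        ((zcos k.1 : ℂ) ^ 2 + (zsin k.1 : ℂ) ^ 2) * m * h2 - m * h1

end Walk

/-! ### Reduction of two marked vertices to a single marked vector. -/

section Search

open Matrix

variable {n : ℕ} [NeZero n]

lemma star_diagAt_dotProduct (m : Vertex n) (ψ : Basis n → ℂ) :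
    star (diagAt n m) ⬝ᵥ ψ = ((Real.sqrt 2 : ℝ) : ℂ)⁻¹ * (ψ (0, m) + ψ (1, m)) := by
  rw [dotProduct, Fintype.sum_prod_type, Fin.sum_univ_two]
  simp only [Pi.star_apply, diagAt, apply_ite star, star_zero, ite_mul, zero_mul,
    Finset.sum_ite_eq', Finset.mem_univ, if_true, star_inv₀]
  rw [show star ((Real.sqrt 2 : ℝ) : ℂ) = ((Real.sqrt 2 : ℝ) : ℂ) from Complex.conj_ofReal _]
  ring

lemma oracle_mulVec (M : Finset (Vertex n)) (ψ : Basis n → ℂ) :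
    oracle n M *ᵥ ψ = ψ - (2 : ℂ) • ∑ m ∈ M, (star (diagAt n m) ⬝ᵥ ψ) • diagAt n m := by
  rw [oracle, sub_mulVec, one_mulVec, smul_mulVec, sum_mulVec]
  congr 2
  refine Finset.sum_congr rfl fun m _ => ?_
  rw [vecMulVec_mulVec]
  ext q
  simp [mul_comm]

/-- Invariance under the point reflection that exchanges `0` and `m`. -/
def IsReflectionInvariant (m : Vertex n) (ψ : Basis n → ℂ) : Prop :=
  ∀ v r, ψ (Fin.rev v, m - r) = ψ (v, r)

omit [NeZero n] in
lemma neg_one_pow_rev (v : Fin 2) : (-1 : ZMod n) ^ (Fin.rev v : ℕ) = -(-1) ^ (v : ℕ) := by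
  fin_cases v <;> simp [Fin.rev]

lemma coinX_rev (v v' : Fin 2) : coinX (Fin.rev v) (Fin.rev v') = coinX v v' := by
  fin_cases v <;> fin_cases v' <;> simp [coinX, Fin.rev]

lemma coinY_rev (v v' : Fin 2) : coinY (Fin.rev v) (Fin.rev v') = coinY v v' := by
  fin_cases v <;> fin_cases v' <;> simp [coinY, Fin.rev]

/-- Flipping the coin label reverses every shift direction, as does the point reflection, and both
coin matrices commute with the flip. -/
lemma IsReflectionInvariant.walk {m : Vertex n} {ψ : Basis n → ℂ}
    (h : IsReflectionInvariant m ψ) : IsReflectionInvariant m (walk n *ᵥ ψ) := by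
  rintro v ⟨x, y⟩
  rw [show m - (x, y) = (m.1 - x, m.2 - y) from rfl, walk_mulVec, walk_mulVec,
    ← Equiv.sum_comp Fin.revPerm]
  refine Finset.sum_congr rfl fun v' _ => ?_
  rw [← Equiv.sum_comp Fin.revPerm (fun v'' => coinX (Fin.revPerm v') v'' * _)]
  simp only [Fin.revPerm_apply, coinX_rev, coinY_rev, neg_one_pow_rev]
  congr 1
  refine Finset.sum_congr rfl fun v'' _ => ?_
  rw [← h v'']
  congr 3
  ext <;> simp <;> ring

lemma IsReflectionInvariant.overlap_eq {m : Vertex n} {ψ : Basis n → ℂ}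
    (h : IsReflectionInvariant m ψ) :
    star (diagAt n m) ⬝ᵥ ψ = star (diagAt n 0) ⬝ᵥ ψ := by
  have h0 := h 0 0
  have h1 := h 1 0
  rw [sub_zero] at h0 h1
  rw [star_diagAt_dotProduct, star_diagAt_dotProduct, ← h0, ← h1, add_comm]
  rfl

omit [NeZero n] in
lemma isReflectionInvariant_diagAt_add (m : Vertex n) :
    IsReflectionInvariant m (diagAt n 0 + diagAt n m) := by
  intro v r
  simp only [Pi.add_apply, diagAt, sub_eq_zero, sub_eq_self, eq_comm (a := m)]
  ring

/-- The unit vector `(|d, 0⟩ + |d, m⟩) / √2`. -/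
def markedVec (m : Vertex n) : EuclideanSpace ℂ (Basis n) :=
  WithLp.toLp 2 (((Real.sqrt 2 : ℝ) : ℂ)⁻¹ • (diagAt n 0 + diagAt n m))

lemma inner_markedVec (m : Vertex n) (ψ : Basis n → ℂ) :
    inner ℂ (markedVec m) (WithLp.toLp 2 ψ) = ((Real.sqrt 2 : ℝ) : ℂ)⁻¹ *
      (star (diagAt n 0) ⬝ᵥ ψ + star (diagAt n m) ⬝ᵥ ψ) := by
  rw [markedVec, EuclideanSpace.inner_toLp_toLp, star_smul, star_add, dotProduct_smul,
    dotProduct_add, dotProduct_comm ψ, dotProduct_comm ψ, smul_eq_mul, star_inv₀]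
  congr 2
  exact Complex.conj_ofReal _

lemma norm_markedVec {m : Vertex n} (hm : m ≠ 0) : ‖markedVec m‖ = 1 := by
  have h := inv_sqrt_two_mul_self
  have h1 : inner ℂ (markedVec m) (markedVec m) = (1 : ℂ) := by
    conv_lhs => rw [markedVec]
    change inner ℂ (markedVec m) _ = _
    rw [inner_markedVec, star_diagAt_dotProduct, star_diagAt_dotProduct]
    simp only [Pi.smul_apply, Pi.add_apply, diagAt, if_true, if_neg hm, if_neg hm.symm,
      smul_eq_mul]
    generalize ((Real.sqrt 2 : ℝ) : ℂ)⁻¹ = σ at h ⊢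
    linear_combination (4 * (σ * σ) + 2) * h
  rw [inner_self_eq_norm_sq_to_K] at h1
  have h2 : ((‖markedVec m‖ ^ 2 : ℝ) : ℂ) = 1 := by rw [← h1]; push_cast; rfl
  have h3 : ‖markedVec m‖ ^ 2 = 1 := by exact_mod_cast h2
  exact (pow_eq_one_iff_of_nonneg (norm_nonneg _) two_ne_zero).mp h3

/-- The state after `t` steps. -/
def searchState (m : Vertex n) (t : ℕ) : EuclideanSpace ℂ (Basis n) :=
  WithLp.toLp 2 ((searchStep n {0, m} ^ t) *ᵥ initialState n)

lemma searchStep_mulVec {m : Vertex n} (hm : m ≠ 0) {ψ : Basis n → ℂ}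
    (h : IsReflectionInvariant m ψ) : searchStep n {0, m} *ᵥ ψ =
      walk n *ᵥ (ψ - (2 * star (diagAt n 0) ⬝ᵥ ψ) • (diagAt n 0 + diagAt n m)) := by
  rw [searchStep, ← mulVec_mulVec, oracle_mulVec, Finset.sum_pair hm.symm, h.overlap_eq,
    ← smul_add, smul_smul]

lemma isReflectionInvariant_orbit {m : Vertex n} (hm : m ≠ 0) (t : ℕ) :
    IsReflectionInvariant m ((searchStep n {0, m} ^ t) *ᵥ initialState n) := by
  induction t with
  | zero => intro v r; simp [initialState]
  | succ t ih =>
    rw [pow_succ', ← mulVec_mulVec, searchStep_mulVec hm ih]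
    refine IsReflectionInvariant.walk fun v r => ?_
    have := isReflectionInvariant_diagAt_add m v r
    simp only [Pi.sub_apply, Pi.smul_apply, ih v r, this]

lemma inner_markedVec_searchState {m : Vertex n} (hm : m ≠ 0) (t : ℕ) :
    inner ℂ (markedVec m) (searchState m t) = (Real.sqrt 2 : ℝ) *
      star (diagAt n 0) ⬝ᵥ ((searchStep n {0, m} ^ t) *ᵥ initialState n) := by
  rw [searchState, inner_markedVec, (isReflectionInvariant_orbit hm t).overlap_eq, ← two_mul,
    ← mul_assoc]
  congr 1
  rw [← mul_right_inj' (Complex.ofReal_ne_zero.mpr (Real.sqrt_ne_zero'.mpr (by norm_num : (0 : ℝ) < 2))),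
    ← mul_assoc, mul_inv_cancel₀, one_mul, ← Complex.ofReal_mul, Real.mul_self_sqrt] <;> norm_num

lemma searchState_succ {m : Vertex n} (hm : m ≠ 0) (t : ℕ) : searchState m (t + 1) =
    walkIso n (searchState m t -
      (2 * inner ℂ (markedVec m) (searchState m t)) • markedVec m) := by
  have h := inv_sqrt_two_mul_self
  have h2 : ((Real.sqrt 2 : ℝ) : ℂ) * ((Real.sqrt 2 : ℝ) : ℂ)⁻¹ = 1 :=
    mul_inv_cancel₀ (Complex.ofReal_ne_zero.mpr (Real.sqrt_ne_zero'.mpr (by norm_num)))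
  rw [inner_markedVec_searchState hm, markedVec, ← WithLp.toLp_smul, smul_smul]
  rw [searchState, pow_succ', ← mulVec_mulVec,
    searchStep_mulVec hm (isReflectionInvariant_orbit hm t), searchState, ← WithLp.toLp_sub,
    walkIso_toLp]
  congr 4
  linear_combination (-2) * (star (diagAt n 0) ⬝ᵥ ((searchStep n {0, m} ^ t) *ᵥ initialState n)) *
    h2

lemma successProb_eq {m : Vertex n} (hm : m ≠ 0) (t : ℕ) :
    successProb n {0, m} t = ‖inner ℂ (markedVec m) (searchState m t)‖ ^ 2 := by
  rw [successProb, Finset.sum_pair hm.symm, (isReflectionInvariant_orbit hm t).overlap_eq,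
    inner_markedVec_searchState hm, norm_mul, mul_pow, Complex.norm_real, Real.norm_eq_abs,
    sq_abs, Real.sq_sqrt (by norm_num), two_mul]

lemma searchState_zero (m : Vertex n) :
    searchState m 0 = diagWave (n := n) 0 := by
  rw [searchState, pow_zero, one_mulVec, diagWave]
  congr 1
  ext q
  simp [initialState, planeWave, mul_comm]

lemma inner_markedVec_searchState_zero (m : Vertex n) :
    ‖inner ℂ (markedVec m) (searchState m 0)‖ = Real.sqrt 2 / n := by
  have h := inv_sqrt_two_mul_self
  have hn : (n : ℂ) ≠ 0 := Nat.cast_ne_zero.mpr (NeZero.ne n)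
  rw [searchState_zero, diagWave, inner_markedVec, star_diagAt_dotProduct, star_diagAt_dotProduct]
  have h2 : ((Real.sqrt 2 : ℝ) : ℂ) * ((Real.sqrt 2 : ℝ) : ℂ)⁻¹ = 1 :=
    mul_inv_cancel₀ (Complex.ofReal_ne_zero.mpr (Real.sqrt_ne_zero'.mpr (by norm_num)))
  have : ((Real.sqrt 2 / n : ℝ) : ℂ) = ((Real.sqrt 2 : ℝ) : ℂ) * (n : ℂ)⁻¹ := by
    push_cast; rw [div_eq_mul_inv]
  have h3 : ‖((Real.sqrt 2 / n : ℝ) : ℂ)‖ = Real.sqrt 2 / n := by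
    rw [Complex.norm_real, Real.norm_eq_abs, abs_of_nonneg (by positivity)]
  rw [← h3, this]
  congr 1
  simp only [planeWave, Prod.fst_zero, Prod.snd_zero, zero_mul, AddChar.map_zero_eq_one, mul_one]
  generalize ((Real.sqrt 2 : ℝ) : ℂ)⁻¹ = σ at h h2 ⊢
  generalize ((Real.sqrt 2 : ℝ) : ℂ) = τ at h2 ⊢
  linear_combination 4 * σ * (n : ℂ)⁻¹ * h + (n : ℂ)⁻¹ * (2 * τ * h - 2 * σ * h2)

/-- The coefficients of the marked vector in the basis of plane waves. -/
def markedCoeff (m k : Vertex n) : ℂ :=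
  ((Real.sqrt 2 : ℝ) : ℂ)⁻¹ * (n : ℂ)⁻¹ *
    (1 + ZMod.stdAddChar (-(k.1 * m.1 + k.2 * m.2)))

/-- Fourier inversion of the point mass at `m`. -/
lemma toLp_diagAt (m : Vertex n) : WithLp.toLp 2 (diagAt n m) =
    ∑ k : Vertex n, ((n : ℂ)⁻¹ * ZMod.stdAddChar (-(k.1 * m.1 + k.2 * m.2))) • diagWave k := by
  have hn : (n : ℂ) ≠ 0 := Nat.cast_ne_zero.mpr (NeZero.ne n)
  ext ⟨v, x, y⟩
  have h1 : ∀ k : Vertex n, (((n : ℂ)⁻¹ * ZMod.stdAddChar (-(k.1 * m.1 + k.2 * m.2))) •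
      diagWave k : EuclideanSpace ℂ (Basis n)) (v, x, y) =
      ((Real.sqrt 2 : ℝ) : ℂ)⁻¹ * ((n : ℂ)⁻¹) ^ 2 *
        (ZMod.stdAddChar ((x - m.1) * k.1) * ZMod.stdAddChar ((y - m.2) * k.2)) := by
    intro k
    rw [PiLp.smul_apply, smul_eq_mul, diagWave, PiLp.toLp_apply, planeWave,
      show -(k.1 * m.1 + k.2 * m.2) = -(m.1 * k.1) + -(m.2 * k.2) by ring, sub_mul, sub_mul,
      sub_eq_add_neg, sub_eq_add_neg, AddChar.map_add_eq_mul, AddChar.map_add_eq_mul,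
      AddChar.map_add_eq_mul, mul_comm k.1, mul_comm k.2]
    ring
  rw [WithLp.ofLp_sum, Finset.sum_apply]
  rw [Finset.sum_congr rfl fun k _ => h1 k, ← Finset.mul_sum, Fintype.sum_prod_type]
  simp only [← Finset.mul_sum, ← Finset.sum_mul, sum_stdAddChar_mul, sub_eq_zero]
  obtain ⟨m1, m2⟩ := m
  simp only [diagAt, Prod.mk.injEq]
  by_cases ha : x = m1 <;> by_cases hb : y = m2 <;> simp [ha, hb]
  field_simp

lemma markedVec_eq (m : Vertex n) : markedVec m = ∑ k, markedCoeff m k • diagWave k := by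
  rw [markedVec, WithLp.toLp_smul, WithLp.toLp_add, toLp_diagAt, toLp_diagAt,
    ← Finset.sum_add_distrib, Finset.smul_sum]
  refine Finset.sum_congr rfl fun k _ => ?_
  rw [← add_smul, smul_smul, markedCoeff]
  congr 1
  simp
  ring

lemma norm_markedCoeff_sq (m k : Vertex n) :
    ‖markedCoeff m k‖ ^ 2 = (1 + zcos (k.1 * m.1 + k.2 * m.2)) / (n : ℝ) ^ 2 := by
  have h := zcos_sq_add_zsin_sq (k.1 * m.1 + k.2 * m.2)
  rw [markedCoeff, stdAddChar_neg_eq]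
  generalize zcos (k.1 * m.1 + k.2 * m.2) = a at h ⊢
  generalize zsin (k.1 * m.1 + k.2 * m.2) = b at h ⊢
  rw [norm_mul, norm_mul, mul_pow, mul_pow, norm_inv, norm_inv, Complex.norm_real,
    Complex.norm_natCast, Real.norm_eq_abs, inv_pow, sq_abs, Real.sq_sqrt (by norm_num),
    Complex.sq_norm, Complex.normSq_apply]
  have h1 : (1 + a) ^ 2 + b ^ 2 = 2 * (1 + a) := by linarith
  simp only [Complex.add_re, Complex.add_im, Complex.sub_re, Complex.sub_im, Complex.one_re,
    Complex.one_im, Complex.ofReal_re, Complex.ofReal_im, Complex.mul_re, Complex.mul_im,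
    Complex.I_re, Complex.I_im]
  ring_nf at h1 ⊢
  linear_combination (n : ℝ)⁻¹ ^ 2 * (1 / 2) * h1

end Search

/-! ### Closed forms and comparison estimates for trigonometric sums over `ZMod n`. -/

section TrigSums

variable {n : ℕ} [NeZero n]

lemma stdAddChar_natCast_eq_exp (k : ℕ) :
    (ZMod.stdAddChar (k : ZMod n) : ℂ) = Complex.exp ((2 * Real.pi * k / n : ℝ) * Complex.I) := by
  have := ZMod.stdAddChar_coe (N := n) (k : ℤ)
  rw [Int.cast_natCast] at this
  rw [this]
  congr 1
  push_cast
  ring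

lemma zcos_natCast (k : ℕ) : zcos (k : ZMod n) = Real.cos (2 * Real.pi * k / n) := by
  rw [zcos, stdAddChar_natCast_eq_exp, Complex.exp_ofReal_mul_I_re]

lemma zsin_natCast (k : ℕ) : zsin (k : ZMod n) = Real.sin (2 * Real.pi * k / n) := by
  rw [zsin, stdAddChar_natCast_eq_exp, Complex.exp_ofReal_mul_I_im]

lemma zcos_add (a b : ZMod n) : zcos (a + b) = zcos a * zcos b - zsin a * zsin b := by
  rw [zcos, AddChar.map_add_eq_mul, Complex.mul_re]; rfl

lemma zsin_add (a b : ZMod n) : zsin (a + b) = zsin a * zcos b + zcos a * zsin b := by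
  rw [zsin, AddChar.map_add_eq_mul, Complex.mul_im, add_comm]; rfl

lemma zcos_neg (a : ZMod n) : zcos (-a) = zcos a := by
  rw [zcos, AddChar.map_neg_eq_conj, Complex.conj_re]; rfl

lemma zsin_neg (a : ZMod n) : zsin (-a) = -zsin a := by
  rw [zsin, AddChar.map_neg_eq_conj, Complex.conj_im]; rfl

lemma zcos_zero : zcos (0 : ZMod n) = 1 := by simp [zcos]

lemma zsin_zero : zsin (0 : ZMod n) = 0 := by simp [zsin]

lemma sum_range_natCast {M : Type*} [AddCommMonoid M] (F : ZMod n → M) :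
    ∑ k ∈ Finset.range n, F k = ∑ k, F k := by
  refine Finset.sum_bij' (fun k _ => (k : ZMod n)) (fun k _ => k.val) (fun _ _ => Finset.mem_univ _)
    (fun k _ => Finset.mem_range.mpr (ZMod.val_lt k)) (fun k hk => ?_) (fun k _ => ?_)
    (fun _ _ => rfl)
  · exact ZMod.val_cast_of_lt (Finset.mem_range.mp hk)
  · exact ZMod.natCast_zmod_val k

lemma sum_zcos_mul (x : ZMod n) : ∑ k : ZMod n, zcos (k * x) = if x = 0 then (n : ℝ) else 0 := by
  have := congrArg Complex.re (sum_stdAddChar_mul x)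
  rw [Complex.re_sum] at this
  simp only [mul_comm x] at this
  change ∑ k : ZMod n, (ZMod.stdAddChar (k * x) : ℂ).re = _
  rw [this]
  split_ifs <;> simp

lemma sum_zsin_mul_zsin (x y : ZMod n) : ∑ k : ZMod n, zsin (k * x) * zsin (k * y) =
    n / 2 * ((if x = y then 1 else 0) - (if x = -y then 1 else 0)) := by
  have h : ∀ k : ZMod n, zsin (k * x) * zsin (k * y) =
      (zcos (k * (x - y)) - zcos (k * (x + y))) / 2 := by
    intro k
    rw [mul_sub, mul_add, sub_eq_add_neg (k * x), zcos_add, zcos_add, zcos_neg, zsin_neg]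
    ring
  simp only [h, ← Finset.sum_div, Finset.sum_sub_distrib, sum_zcos_mul, sub_eq_zero,
    add_eq_zero_iff_eq_neg]
  split_ifs <;> ring

/-- Telescoping through the three-term recurrence of the sines of successive multiples of an angle.
-/
lemma mul_sum_pow_mul_zsin (ρ : ℝ) (k : ZMod n) (m : ℕ) :
    (1 - 2 * ρ * zcos k + ρ ^ 2) * ∑ j ∈ Finset.range m, ρ ^ j * zsin (k * ((j + 1 : ℕ) : ZMod n)) =
      zsin k - ρ ^ m * zsin (k * ((m + 1 : ℕ) : ZMod n)) + ρ ^ (m + 1) * zsin (k * (m : ZMod n)) := by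
  induction m with
  | zero => simp [zsin_zero]
  | succ m ih =>
    rw [Finset.sum_range_succ, mul_add, ih]
    have h1 : zsin (k * ((m + 1 + 1 : ℕ) : ZMod n)) =
        2 * zcos k * zsin (k * ((m + 1 : ℕ) : ZMod n)) - zsin (k * (m : ZMod n)) := by
      have e1 : k * ((m + 1 + 1 : ℕ) : ZMod n) = k * ((m + 1 : ℕ) : ZMod n) + k := by
        push_cast; ring
      have e2 : k * (m : ZMod n) = k * ((m + 1 : ℕ) : ZMod n) + -k := by push_cast; ring
      rw [e1, e2, zsin_add, zsin_add, zcos_neg, zsin_neg]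
      ring
    rw [h1]
    ring

lemma mul_sum_pow_mul_zsin_eq (ρ : ℝ) (k : ZMod n) :
    (1 - 2 * ρ * zcos k + ρ ^ 2) * ∑ j ∈ Finset.range n, ρ ^ j * zsin (k * ((j + 1 : ℕ) : ZMod n)) =
      (1 - ρ ^ n) * zsin k := by
  rw [mul_sum_pow_mul_zsin]
  push_cast
  simp [zsin_zero]
  ring

/-- The discrete sine transform of the conjugate Poisson kernel. -/
lemma sum_zsin_mul_div {c s : ℝ} (hcs : c ^ 2 + s ^ 2 = 1) (hs : 0 < s) {x : ℕ} (hx0 : 0 < x)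
    (hxn : x < n) : (1 - (c / (1 + s)) ^ n) *
      ∑ k : ZMod n, zsin (k * (x : ZMod n)) * (zsin k / (1 - c * zcos k)) =
      n * (1 + s)⁻¹ * ((c / (1 + s)) ^ (x - 1) - (c / (1 + s)) ^ (n - x - 1)) := by
  set ρ := c / (1 + s) with hρ
  have hs1 : 0 < 1 + s := by linarith
  have hc1 : |c| < 1 := by
    rw [← sq_lt_one_iff_abs_lt_one]; nlinarith
  have hz : ∀ k : ZMod n, 0 < 1 - c * zcos k := by
    intro k
    have h1 : |zcos k| ≤ 1 := by
      rw [← sq_le_one_iff_abs_le_one]; nlinarith [zcos_sq_add_zsin_sq k, sq_nonneg (zsin k)]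
    have h2 : |c * zcos k| < 1 := by
      rw [abs_mul]
      calc |c| * |zcos k| ≤ |c| * 1 := mul_le_mul_of_nonneg_left h1 (abs_nonneg _)
        _ < 1 := by linarith
    linarith [le_abs_self (c * zcos k)]
  have hk : ∀ k : ZMod n, (1 - ρ ^ n) * (zsin k / (1 - c * zcos k)) =
      2 * (1 + s)⁻¹ * ∑ j ∈ Finset.range n, ρ ^ j * zsin (k * ((j + 1 : ℕ) : ZMod n)) := by
    intro k
    rw [← mul_div_assoc, div_eq_iff (hz k).ne', ← mul_sum_pow_mul_zsin_eq]
    -- The reason for `ρ = c / (1 + s)`: it turns the given denominator into a Poisson kernel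
    -- denominator.
    have : 1 - 2 * ρ * zcos k + ρ ^ 2 = 2 * (1 + s)⁻¹ * (1 - c * zcos k) := by
      rw [hρ]
      field_simp
      linear_combination hcs
    rw [this]
    ring
  -- Orthogonality of sines modulo `n` will select `j + 1 = x` and its mirror image `j + 1 = n - x`.
  have h1 : ∀ j : ℕ, j < n → ((x : ZMod n) = ((j + 1 : ℕ) : ZMod n) ↔ j = x - 1) := by
    intro j hj
    rw [ZMod.natCast_eq_natCast_iff', Nat.mod_eq_of_lt hxn]
    rcases Nat.lt_or_ge (j + 1) n with h | h
    · rw [Nat.mod_eq_of_lt h]; omega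
    · rw [show j + 1 = n by omega, Nat.mod_self]; omega
  have h2 : ∀ j : ℕ, j < n → ((x : ZMod n) = -((j + 1 : ℕ) : ZMod n) ↔ j = n - x - 1) := by
    intro j hj
    rw [eq_neg_iff_add_eq_zero, ← Nat.cast_add, ZMod.natCast_eq_zero_iff]
    constructor
    · rintro ⟨q, hq⟩
      have hq1 : q = 1 := by
        rcases q with _ | _ | q
        · omega
        · rfl
        · exfalso
          have : n * 2 ≤ n * (q + 1 + 1) := Nat.mul_le_mul_left _ (by omega)
          omega
      subst hq1; omega
    · rintro rfl
      exact ⟨1, by omega⟩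
  calc (1 - ρ ^ n) * ∑ k : ZMod n, zsin (k * (x : ZMod n)) * (zsin k / (1 - c * zcos k))
      = ∑ k : ZMod n, zsin (k * (x : ZMod n)) *
          (2 * (1 + s)⁻¹ * ∑ j ∈ Finset.range n, ρ ^ j * zsin (k * ((j + 1 : ℕ) : ZMod n))) := by
        rw [Finset.mul_sum]
        refine Finset.sum_congr rfl fun k _ => ?_
        rw [← hk]; ring
    _ = 2 * (1 + s)⁻¹ * ∑ j ∈ Finset.range n, ρ ^ j *
          ∑ k : ZMod n, zsin (k * (x : ZMod n)) * zsin (k * ((j + 1 : ℕ) : ZMod n)) := by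
        simp only [Finset.mul_sum]
        rw [Finset.sum_comm]
        refine Finset.sum_congr rfl fun j _ => Finset.sum_congr rfl fun k _ => ?_
        ring
    _ = 2 * (1 + s)⁻¹ * ∑ j ∈ Finset.range n, ((if j = x - 1 then (n / 2) * ρ ^ j else 0) -
          (if j = n - x - 1 then (n / 2) * ρ ^ j else 0)) := by
        congr 1
        refine Finset.sum_congr rfl fun j hj => ?_
        rw [sum_zsin_mul_zsin]
        simp only [h1 j (Finset.mem_range.mp hj), h2 j (Finset.mem_range.mp hj)]
        split_ifs <;> ring
    _ = _ := by
        rw [Finset.sum_sub_distrib, Finset.sum_ite_eq', Finset.sum_ite_eq',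
          if_pos (Finset.mem_range.mpr (by omega)), if_pos (Finset.mem_range.mpr (by omega))]
        ring

/-- The closed form decays like `(1 + s)⁻¹` to the power of the cyclic distance. The hypothesis `2 ≤
n * s` makes `|ρ ^ n| ≤ 1/3` by Bernoulli, so dividing by `1 - ρ ^ n` is harmless. -/
lemma abs_sum_zsin_mul_div_le {c s : ℝ} (hcs : c ^ 2 + s ^ 2 = 1) (hs : 0 < s)
    (hns : 2 ≤ n * s) {x : ℕ} (hx0 : 0 < x) (hxn : x < n) :
    |∑ k : ZMod n, zsin (k * (x : ZMod n)) * (zsin k / (1 - c * zcos k))| ≤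
      3 * n * ((1 + s) ^ cyc n x)⁻¹ := by
  have h := sum_zsin_mul_div hcs hs hx0 hxn
  set S := ∑ k : ZMod n, zsin (k * (x : ZMod n)) * (zsin k / (1 - c * zcos k))
  set ρ := c / (1 + s) with hρ
  set κ := (1 + s)⁻¹ with hκ
  have hs1 : 0 < 1 + s := by linarith
  have hκ0 : 0 < κ := inv_pos.mpr hs1
  have hκ1 : κ ≤ 1 := inv_le_one_of_one_le₀ (by linarith)
  have hc1 : |c| ≤ 1 := by
    rw [← sq_le_one_iff_abs_le_one]; nlinarith
  have hρκ : |ρ| ≤ κ := by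
    rw [hρ, abs_div, abs_of_pos hs1, hκ, div_eq_mul_inv]
    exact mul_le_of_le_one_left hκ0.le hc1
  have hp : ∀ j, |ρ ^ j| ≤ κ ^ j := fun j => by
    rw [abs_pow]; exact pow_le_pow_left₀ (abs_nonneg _) hρκ j
  have hκn : κ ^ n ≤ 1 / 3 := by
    rw [hκ, inv_pow, one_div]
    refine inv_anti₀ (by norm_num) ?_
    have := one_add_mul_le_pow (by linarith : (-2 : ℝ) ≤ s) n
    linarith
  have hρn : 2 / 3 ≤ 1 - ρ ^ n := by
    have := (le_abs_self _).trans (hp n)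
    linarith
  have hX : 1 ≤ cyc n x := by unfold cyc; omega
  -- The prefactor `κ` makes up for the exponents being one short of the distance.
  have hp' : ∀ j, cyc n x - 1 ≤ j → κ * |ρ ^ j| ≤ κ ^ cyc n x := fun j hj => by
    calc κ * |ρ ^ j| ≤ κ * κ ^ j := mul_le_mul_of_nonneg_left (hp j) hκ0.le
      _ = κ ^ (j + 1) := by ring
      _ ≤ κ ^ cyc n x := pow_le_pow_of_le_one hκ0.le hκ1 (by omega)
  have h1 : |(1 - ρ ^ n) * S| ≤ n * (2 * κ ^ cyc n x) := by
    rw [h, mul_assoc, abs_mul, Nat.abs_cast]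
    refine mul_le_mul_of_nonneg_left ?_ (Nat.cast_nonneg _)
    rw [abs_mul, abs_of_pos hκ0]
    have e1 := hp' (x - 1) (by unfold cyc; omega)
    have e2 := hp' (n - x - 1) (by unfold cyc; omega)
    have e3 := mul_le_mul_of_nonneg_left (abs_sub (ρ ^ (x - 1)) (ρ ^ (n - x - 1))) hκ0.le
    linarith
  rw [abs_mul, abs_of_pos (by linarith)] at h1
  have h2 : 2 / 3 * |S| ≤ (1 - ρ ^ n) * |S| := mul_le_mul_of_nonneg_right hρn (abs_nonneg _)
  rw [← inv_pow, ← hκ]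
  linarith

lemma sum_inv_add_mul_sq_le {u δ : ℝ} (hu : 0 < u) (hδ : 0 < δ) (M : ℕ) :
    ∑ m ∈ Finset.Icc 1 M, ((u + δ * m) ^ 2)⁻¹ ≤ (δ * u)⁻¹ := by
  have h : ∑ m ∈ Finset.Icc 1 M, ((u + δ * m) ^ 2)⁻¹ ≤ δ⁻¹ * (u⁻¹ - (u + δ * M)⁻¹) := by
    induction M with
    | zero => simp
    | succ M ih =>
      rw [Finset.sum_Icc_succ_top (by omega)]
      have e1 : ((u + δ * (M + 1 : ℕ)) ^ 2)⁻¹ ≤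
          δ⁻¹ * ((u + δ * M)⁻¹ - (u + δ * (M + 1 : ℕ))⁻¹) := by
        push_cast
        have p1 : 0 < u + δ * M := by positivity
        have p2 : 0 < u + δ * (M + 1) := by positivity
        have : δ⁻¹ * ((u + δ * M)⁻¹ - (u + δ * (M + 1))⁻¹) =
            ((u + δ * M) * (u + δ * (M + 1)))⁻¹ := by
          field_simp
          ring
        rw [this]
        refine inv_anti₀ (by positivity) ?_
        rw [sq]
        exact mul_le_mul_of_nonneg_right (by linarith) p2.le
      linarith
  refine h.trans ?_
  rw [mul_inv]
  refine mul_le_mul_of_nonneg_left ?_ (by positivity)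
  have : 0 ≤ (u + δ * M)⁻¹ := by positivity
  linarith

lemma two_mul_div_le_sin {m : ℕ} (hm : 2 * m ≤ n) :
    2 * (m : ℝ) / n ≤ Real.sin (Real.pi * m / n) := by
  have hn : (0 : ℝ) < n := Nat.cast_pos.mpr (NeZero.pos n)
  have hm' : 2 * (m : ℝ) ≤ n := by exact_mod_cast hm
  have h := Real.mul_le_sin (x := Real.pi * m / n) (by positivity) (by
    rw [div_le_div_iff₀ hn two_pos]
    nlinarith [Real.pi_pos])
  calc 2 * (m : ℝ) / n = 2 / Real.pi * (Real.pi * m / n) := by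
        have := Real.pi_ne_zero
        field_simp
    _ ≤ _ := h

lemma sin_pi_mul_div_sub {m : ℕ} (hm : m ≤ n) :
    Real.sin (Real.pi * (n - m : ℕ) / n) = Real.sin (Real.pi * m / n) := by
  have hn : (n : ℝ) ≠ 0 := Nat.cast_ne_zero.mpr (NeZero.ne n)
  rw [← Real.sin_pi_sub (Real.pi * m / n)]
  congr 1
  rw [Nat.cast_sub hm]
  field_simp

/-- Comparison of a sum over the values of `|sin|` with a sum over an arithmetic progression. -/
lemma sum_abs_zsin_le {G : ℝ → ℝ} (h0 : G 0 = 0) (hpos : ∀ t, 0 ≤ G t)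
    (hanti : AntitoneOn G (Set.Ioi 0)) :
    ∑ k : ZMod n, G |zsin k| ≤ 4 * ∑ m ∈ Finset.Icc 1 (n - 1), G (2 * m / n) := by
  have hn : (0 : ℝ) < n := Nat.cast_pos.mpr (NeZero.pos n)
  have hn0 : 0 < n := NeZero.pos n
  set F : ℕ → ℝ := fun m => G |Real.sin (Real.pi * m / n)| with hF
  have e1 : ∑ k : ZMod n, G |zsin k| = ∑ k ∈ Finset.range n, F (2 * k) := by
    rw [← sum_range_natCast]
    refine Finset.sum_congr rfl fun k _ => ?_
    rw [zsin_natCast, hF]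
    congr 3
    push_cast
    ring
  -- Even multiples of π/n are enlarged to all multiples over two periods of |sin|: the first factor
  -- 2.
  have e2 : ∑ k ∈ Finset.range n, F (2 * k) ≤ ∑ m ∈ Finset.range (n + n), F m := by
    rw [← Finset.sum_image (f := F) (g := fun k => 2 * k) (fun a _ b _ h => by
      simpa using h)]
    refine Finset.sum_le_sum_of_subset_of_nonneg ?_ fun _ _ _ => hpos _
    intro m hm
    simp only [Finset.mem_image, Finset.mem_range] at hm ⊢
    omega
  have e3 : ∀ m, F (n + m) = F m := by
    intro m
    simp only [hF]
    rw [show Real.pi * ((n + m : ℕ) : ℝ) / n = Real.pi * m / n + Real.pi by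
      push_cast; field_simp; ring, Real.sin_add_pi, abs_neg]
  have e4 : ∑ m ∈ Finset.range n, F m = ∑ m ∈ Finset.Icc 1 (n - 1), F m := by
    rw [Finset.range_eq_Ico, ← Finset.sum_sdiff (s₁ := Finset.Icc 1 (n - 1)) (by
      intro m; simp only [Finset.mem_Icc, Finset.mem_Ico]; omega)]
    rw [add_eq_right]
    refine Finset.sum_eq_zero fun m hm => ?_
    simp only [Finset.mem_sdiff, Finset.mem_Ico, Finset.mem_Icc] at hm
    have : m = 0 := by omega
    simp [hF, this, h0]
  -- Jordan's inequality at the nearer end of the interval; keeping both ends costs the second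
  -- factor 2.
  have e5 : ∀ m ∈ Finset.Icc 1 (n - 1), F m ≤ G (2 * m / n) + G (2 * (n - m : ℕ) / n) := by
    intro m hm
    rw [Finset.mem_Icc] at hm
    have key : ∀ j : ℕ, 1 ≤ j → 2 * j ≤ n →
        Real.sin (Real.pi * j / n) = Real.sin (Real.pi * m / n) → F m ≤ G (2 * j / n) := by
      intro j hj1 hj2 hj
      have p1 : 0 < 2 * (j : ℝ) / n := by
        have : (0 : ℝ) < j := by exact_mod_cast hj1
        positivity
      have p2 := two_mul_div_le_sin hj2
      rw [hj] at p2
      simp only [hF]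
      rw [abs_of_pos (p1.trans_le p2)]
      exact hanti p1 (p1.trans_le p2) p2
    rcases Nat.lt_or_ge n (2 * m) with h | h
    · exact (key (n - m) (by omega) (by omega) (sin_pi_mul_div_sub (by omega))).trans
        (le_add_of_nonneg_left (hpos _))
    · exact (key m (by omega) (by omega) rfl).trans (le_add_of_nonneg_right (hpos _))
  have e6 : ∑ m ∈ Finset.Icc 1 (n - 1), G (2 * (n - m : ℕ) / n) =
      ∑ m ∈ Finset.Icc 1 (n - 1), G (2 * m / n) := by
    refine Finset.sum_nbij' (fun m => n - m) (fun m => n - m) (fun m hm => ?_) (fun m hm => ?_)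
      (fun m hm => ?_) (fun m hm => ?_) (fun _ _ => rfl) <;>
      simp only [Finset.mem_Icc] at hm ⊢ <;> omega
  have e7 := Finset.sum_le_sum e5
  rw [Finset.sum_add_distrib, e6] at e7
  rw [Finset.sum_range_add] at e2
  simp only [e3] at e2
  linarith

/-- `sum_abs_zsin_le` applied to the indicator of `(0, 2/n)`: the comparison sum vanishes, so no
sine lies there. -/
lemma two_div_le_abs_zsin {k : ZMod n} (hk : zsin k ≠ 0) : 2 / (n : ℝ) ≤ |zsin k| := by
  by_contra! hlt
  set G : ℝ → ℝ := fun t => if 0 < t ∧ t < 2 / (n : ℝ) then 1 else 0 with hG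
  have hn : (0 : ℝ) < n := Nat.cast_pos.mpr (NeZero.pos n)
  have h1 := sum_abs_zsin_le (n := n) (G := G) (by simp [hG])
    (fun t => by simp only [hG]; split_ifs <;> norm_num) (by
      intro a ha b hb hab
      simp only [hG, Set.mem_Ioi] at *
      split_ifs with h2 h3
      · exact le_rfl
      · exact absurd ⟨ha, by linarith⟩ h3
      · norm_num
      · exact le_rfl)
  have h2 : ∑ m ∈ Finset.Icc 1 (n - 1), G (2 * m / n) = 0 := by
    refine Finset.sum_eq_zero fun m hm => ?_
    rw [Finset.mem_Icc] at hm
    simp only [hG]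
    rw [if_neg]
    rintro ⟨-, h⟩
    rw [div_lt_div_iff_of_pos_right hn] at h
    have : (1 : ℝ) ≤ m := by exact_mod_cast hm.1
    linarith
  have h3 : G |zsin k| ≤ ∑ k : ZMod n, G |zsin k| :=
    Finset.single_le_sum (f := fun k : ZMod n => G |zsin k|)
      (fun t _ => by simp only [hG]; split_ifs <;> norm_num) (Finset.mem_univ k)
  rw [h2] at h1
  have h4 : G |zsin k| = 1 := by simp only [hG]; rw [if_pos ⟨abs_pos.mpr hk, hlt⟩]
  linarith

end TrigSums

/-! ### The bound on the interference sum. -/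

section Interference

variable {n : ℕ} [NeZero n]

lemma zcos_mul_zcos_le_one (k l : ZMod n) : zcos k * zcos l ≤ 1 := by
  nlinarith [sq_nonneg (zcos k - zcos l), zcos_sq_add_zsin_sq k, zcos_sq_add_zsin_sq l,
    sq_nonneg (zsin k), sq_nonneg (zsin l)]

/-- The frequencies excluded by the filter have zero denominator, so their terms are zero anyway. -/
lemma interference_eq_sum (x y : ℕ) : interference n x y = -(1 / 2) * ∑ k : ZMod n, ∑ l : ZMod n,
    zcos (k * (x : ZMod n) + l * (y : ZMod n)) * (zsin k * zsin l / (1 - zcos k * zcos l)) := by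
  rw [interference, ← sum_range_natCast, Finset.sum_filter_of_ne, Finset.sum_product]
  · congr 1
    refine Finset.sum_congr rfl fun k _ => ?_
    rw [← sum_range_natCast]
    refine Finset.sum_congr rfl fun l _ => ?_
    have h : zcos ((k : ZMod n) * (x : ZMod n) + (l : ZMod n) * (y : ZMod n)) =
        Real.cos (2 * Real.pi * ((k : ℝ) * x + (l : ℝ) * y) / n) := by
      rw [← Nat.cast_mul, ← Nat.cast_mul, ← Nat.cast_add, zcos_natCast]
      push_cast
      rfl
    rw [zcos_natCast, zcos_natCast, zsin_natCast, zsin_natCast, h]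
    rfl
  · rintro ⟨k, l⟩ - hne h0
    apply hne
    rw [phase, Real.arccos_eq_zero, angle, angle, ← zcos_natCast, ← zcos_natCast] at h0
    simp only [angle, ← zcos_natCast]
    rw [le_antisymm (zcos_mul_zcos_le_one _ _) h0, sub_self, div_zero, mul_zero]

lemma interference_comm (x y : ℕ) : interference n x y = interference n y x := by
  rw [interference_eq_sum, interference_eq_sum, Finset.sum_comm]
  congr 1
  refine Finset.sum_congr rfl fun k _ => Finset.sum_congr rfl fun l _ => ?_
  rw [add_comm (l * _), mul_comm (zsin l), mul_comm (zcos l)]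

lemma sum_zmod_eq_zero_of_odd {F : ZMod n → ℝ} (hF : ∀ k, F (-k) = -F k) : ∑ k, F k = 0 := by
  have h := Equiv.sum_comp (Equiv.neg (ZMod n)) F
  simp only [Equiv.neg_apply, hF, Finset.sum_neg_distrib] at h
  linarith

/-- After expanding the cosine of the sum, the cosine–cosine part is odd in `k` and vanishes. -/
lemma interference_eq_sine_sum (x y : ℕ) : interference n x y = 1 / 2 * ∑ l : ZMod n,
    zsin (l * (y : ZMod n)) * zsin l * ∑ k : ZMod n, zsin (k * (x : ZMod n)) * (zsin k / (1 - zcos l * zcos k)) := by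
  rw [interference_eq_sum, Finset.sum_comm, neg_mul, ← mul_neg, ← Finset.sum_neg_distrib]
  congr 1
  refine Finset.sum_congr rfl fun l _ => ?_
  have h1 : ∀ k : ZMod n, zcos (k * (x : ZMod n) + l * (y : ZMod n)) * (zsin k * zsin l / (1 - zcos k * zcos l)) =
      zcos (l * (y : ZMod n)) * zsin l * (zcos (k * (x : ZMod n)) * (zsin k / (1 - zcos l * zcos k))) -
      zsin (l * (y : ZMod n)) * zsin l * (zsin (k * (x : ZMod n)) * (zsin k / (1 - zcos l * zcos k))) := by
    intro k
    rw [zcos_add, mul_comm (zcos k)]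
    ring
  simp only [h1, Finset.sum_sub_distrib, ← Finset.mul_sum]
  rw [sum_zmod_eq_zero_of_odd (F := fun k => zcos (k * (x : ZMod n)) * (zsin k / (1 - zcos l * zcos k)))]
  · ring
  · intro k
    rw [neg_mul, zcos_neg, zcos_neg, zsin_neg]
    ring

/-- Bernoulli with exponent `X / 3`, then cubed. A cube suffices: one power absorbs the factor `s`
in the sum over `l`, and two remain for summability. -/
lemma one_add_mul_pow_three_le {s : ℝ} (hs0 : 0 ≤ s) (hs1 : s ≤ 1) {X : ℕ} (hX : 1 ≤ X) :
    (1 + s * X) ^ 3 ≤ 64 * (1 + s) ^ X := by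
  have hX' : (1 : ℝ) ≤ X := by exact_mod_cast hX
  rcases Nat.lt_or_ge X 3 with h | h
  · have h2 : (X : ℝ) ≤ 3 := by exact_mod_cast h.le
    have h3 : 1 + s * X ≤ 4 := by nlinarith
    calc (1 + s * X) ^ 3 ≤ 4 ^ 3 := pow_le_pow_left₀ (by positivity) h3 3
      _ ≤ 64 * 1 := by norm_num
      _ ≤ _ := mul_le_mul_of_nonneg_left (one_le_pow₀ (by linarith)) (by norm_num)
  · have h4 : (3 : ℝ) ≤ X := by exact_mod_cast h
    have h2 : 1 + (X / 3 : ℝ) * s ≤ (1 + s) ^ (X / 3 : ℝ) :=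
      one_add_mul_self_le_rpow_one_add (by linarith) (by linarith)
    have h3 : ((1 + s) ^ (X / 3 : ℝ)) ^ 3 = (1 + s) ^ X := by
      rw [← Real.rpow_natCast, ← Real.rpow_mul (by linarith), ← Real.rpow_natCast]
      congr 1
      push_cast
      ring
    have h5 : (1 + (X / 3 : ℝ) * s) ^ 3 ≤ (1 + s) ^ X := by
      rw [← h3]; exact pow_le_pow_left₀ (by positivity) h2 3
    have h6 : (1 + s * X) ^ 3 ≤ (3 * (1 + (X / 3 : ℝ) * s)) ^ 3 :=
      pow_le_pow_left₀ (by positivity) (by linarith) 3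
    have h7 : (0 : ℝ) ≤ (1 + s) ^ X := by positivity
    calc (1 + s * X) ^ 3 ≤ 27 * (1 + (X / 3 : ℝ) * s) ^ 3 := by rw [mul_pow] at h6; linarith
      _ ≤ _ := by linarith

lemma abs_zsin_le_one (k : ZMod n) : |zsin k| ≤ 1 := by
  rw [← sq_le_one_iff_abs_le_one]; nlinarith [zcos_sq_add_zsin_sq k, sq_nonneg (zcos k)]

/-- Decay in the first coordinate alone, with `|zsin (l * y)| ≤ 1`. Frequencies `l` with `zsin l =
0` contribute nothing; the others satisfy `n |zsin l| ≥ 2`, as the kernel bound requires. -/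
lemma abs_interference_le_left {x : ℕ} (hx0 : 0 < x) (hxn : x < n) (y : ℕ) :
    |interference n x y| ≤ 192 * ((n : ℝ) ^ 2 / (cyc n x : ℝ) ^ 2) := by
  have hn : (0 : ℝ) < n := Nat.cast_pos.mpr (NeZero.pos n)
  set X := cyc n x with hX
  have hX1 : 1 ≤ X := by rw [hX]; unfold cyc; omega
  have hX0 : (0 : ℝ) < X := by exact_mod_cast hX1
  set G : ℝ → ℝ := fun t => if t = 0 then 0 else 192 * n / X * ((1 + X * t) ^ 2)⁻¹ with hG
  have hterm : ∀ l : ZMod n, |zsin (l * (y : ZMod n)) * zsin l *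
      ∑ k : ZMod n, zsin (k * (x : ZMod n)) * (zsin k / (1 - zcos l * zcos k))| ≤ G |zsin l| := by
    intro l
    by_cases hl : zsin l = 0
    · simp [hl, hG]
    have hs : 0 < |zsin l| := abs_pos.mpr hl
    have h1 := abs_sum_zsin_mul_div_le (n := n) (c := zcos l) (s := |zsin l|)
      (by rw [sq_abs]; exact zcos_sq_add_zsin_sq l) hs (by
        have := two_div_le_abs_zsin hl
        rw [div_le_iff₀ hn] at this
        linarith) hx0 hxn
    rw [← hX] at h1
    simp only [hG, if_neg hs.ne']
    rw [abs_mul, abs_mul]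
    set s := |zsin l|
    have hs1 : s ≤ 1 := abs_zsin_le_one l
    have h2 := one_add_mul_pow_three_le hs.le hs1 hX1
    have h3 : ((1 + s) ^ X)⁻¹ ≤ 64 * ((1 + s * X) ^ 3)⁻¹ := by
      rw [← div_eq_mul_inv, inv_le_comm₀ (by positivity) (by positivity), inv_div,
        div_le_iff₀ (by norm_num)]
      linarith
    have h4 : s * ((1 + s * X) ^ 3)⁻¹ ≤ (X : ℝ)⁻¹ * ((1 + X * s) ^ 2)⁻¹ := by
      rw [← mul_inv, ← div_eq_mul_inv, ← one_div, div_le_div_iff₀ (by positivity) (by positivity)]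
      have : 0 ≤ (1 + s * X) ^ 2 := by positivity
      nlinarith
    calc |zsin (l * (y : ZMod n))| * s * |∑ k : ZMod n, zsin (k * (x : ZMod n)) * (zsin k / (1 - zcos l * zcos k))|
        ≤ 1 * s * (3 * n * (64 * ((1 + s * X) ^ 3)⁻¹)) := by
          refine mul_le_mul (mul_le_mul_of_nonneg_right (abs_zsin_le_one _) hs.le) (h1.trans ?_)
            (abs_nonneg _) (by linarith)
          exact mul_le_mul_of_nonneg_left h3 (by positivity)
      _ = 192 * n * (s * ((1 + s * X) ^ 3)⁻¹) := by ring
      _ ≤ 192 * n * ((X : ℝ)⁻¹ * ((1 + X * s) ^ 2)⁻¹) :=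
          mul_le_mul_of_nonneg_left h4 (by positivity)
      _ = _ := by ring
  have hsum := sum_abs_zsin_le (n := n) (G := G) (by simp [hG])
    (fun t => by simp only [hG]; split_ifs <;> positivity) (by
      intro a ha b hb hab
      rw [Set.mem_Ioi] at ha hb
      simp only [hG, if_neg ha.ne', if_neg hb.ne']
      refine mul_le_mul_of_nonneg_left (inv_anti₀ (by positivity) ?_) (by positivity)
      gcongr)
  have hG2 : ∑ m ∈ Finset.Icc 1 (n - 1), G (2 * m / n) ≤
      192 * n / X * ((2 * (X : ℝ) / n) * 1)⁻¹ := by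
    refine le_trans ?_ (mul_le_mul_of_nonneg_left (sum_inv_add_mul_sq_le one_pos
      (by positivity : 0 < 2 * (X : ℝ) / n) (n - 1)) (by positivity))
    rw [Finset.mul_sum]
    refine Finset.sum_le_sum fun m hm => ?_
    simp only [hG]
    split_ifs
    · positivity
    · rw [show 2 * (X : ℝ) / n * m = X * (2 * m / n) by ring]
  rw [interference_eq_sine_sum, abs_mul, abs_of_pos (by norm_num : (0 : ℝ) < 1 / 2)]
  have h6 := ((Finset.abs_sum_le_sum_abs _ Finset.univ).trans
    (Finset.sum_le_sum fun l _ => hterm l)).trans hsum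
  calc _ ≤ 1 / 2 * (4 * (192 * n / X * ((2 * (X : ℝ) / n) * 1)⁻¹)) := by
        refine mul_le_mul_of_nonneg_left (h6.trans ?_) (by norm_num)
        linarith
    _ = _ := by field_simp; ring

theorem abs_interference_le {x y : ℕ} (hx0 : 0 < x) (hxn : x < n) (hy0 : 0 < y) (hyn : y < n) :
    |interference n x y| ≤ 192 * ((n : ℝ) ^ 2 / ((cyc n x : ℝ) * (cyc n y : ℝ))) := by
  have hX : (0 : ℝ) < cyc n x := by
    have : 0 < cyc n x := by unfold cyc; omega
    exact_mod_cast this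
  have hY : (0 : ℝ) < cyc n y := by
    have : 0 < cyc n y := by unfold cyc; omega
    exact_mod_cast this
  -- The one-coordinate bound is used for the larger distance, whose square dominates the product.
  rcases le_total (cyc n x : ℝ) (cyc n y : ℝ) with h | h
  · rw [interference_comm]
    refine (abs_interference_le_left hy0 hyn x).trans ?_
    rw [sq (cyc n y : ℝ)]
    gcongr
  · refine (abs_interference_le_left hx0 hxn y).trans ?_
    rw [sq (cyc n x : ℝ)]
    gcongr

end Interference

/-! ### The energy is of logarithmic order. -/

section EnergyBounds

variable {n : ℕ} [NeZero n]

/-- The difference of the two sides is the square of `zcos k - zcos l`. -/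
lemma zsin_sq_add_zsin_sq_le (k l : ZMod n) :
    zsin k ^ 2 + zsin l ^ 2 ≤ 2 - 2 * (zcos k * zcos l) := by
  nlinarith [sq_nonneg (zcos k - zcos l), zcos_sq_add_zsin_sq k, zcos_sq_add_zsin_sq l]

lemma inv_two_sub_le_inv {k l : ZMod n} (h : zsin l ≠ 0) :
    (2 - 2 * (zcos k * zcos l))⁻¹ ≤ (zsin k ^ 2 + zsin l ^ 2)⁻¹ := by
  have : 0 < zsin l ^ 2 := by positivity
  exact inv_anti₀ (by positivity) (zsin_sq_add_zsin_sq_le k l)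

lemma inv_two_sub_le_quarter {k l : ZMod n} (hk : zsin k = 0) (hl : zsin l = 0) :
    (2 - 2 * (zcos k * zcos l))⁻¹ ≤ 1 / 4 := by
  have h1 := zcos_sq_add_zsin_sq k
  have h2 := zcos_sq_add_zsin_sq l
  rw [hk] at h1
  rw [hl] at h2
  have h3 : zcos k * zcos l = 1 ∨ zcos k * zcos l = -1 := by
    rw [← sq_eq_one_iff, mul_pow]
    nlinarith
  rcases h3 with h | h <;> rw [h] <;> norm_num

/-- The spectral gap, supplying `Γ` in `IsBlockFamily.overlap_le`. When both sines vanish the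
inverse is 0 or 1/4. -/
lemma inv_two_sub_le (k l : ZMod n) : (2 - 2 * (zcos k * zcos l))⁻¹ ≤ (n : ℝ) ^ 2 / 4 := by
  have hn : (1 : ℝ) ≤ n := by exact_mod_cast NeZero.one_le (n := n)
  have key : ∀ k l : ZMod n, zsin l ≠ 0 → (2 - 2 * (zcos k * zcos l))⁻¹ ≤ (n : ℝ) ^ 2 / 4 := by
    intro k l hl
    refine (inv_two_sub_le_inv hl).trans ?_
    have h1 := two_div_le_abs_zsin hl
    have h2 : (2 / (n : ℝ)) ^ 2 ≤ zsin l ^ 2 := by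
      rw [← sq_abs (zsin l)]; exact pow_le_pow_left₀ (by positivity) h1 2
    calc (zsin k ^ 2 + zsin l ^ 2)⁻¹ ≤ ((2 / (n : ℝ)) ^ 2)⁻¹ :=
          inv_anti₀ (by positivity) (by nlinarith [sq_nonneg (zsin k)])
      _ = _ := by field_simp; norm_num
  by_cases hl : zsin l = 0
  · by_cases hk : zsin k = 0
    · refine (inv_two_sub_le_quarter hk hl).trans ?_
      gcongr
      exact one_le_pow₀ hn
    · rw [mul_comm (zcos k)]
      exact key l k hk
  · exact key k l hl

open Classical in
lemma card_zsin_eq_zero_le : (Finset.univ.filter fun k : ZMod n => zsin k = 0).card ≤ 2 := by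
  have : (({1, -1} : Finset ℂ)).card ≤ 2 := Finset.card_le_two
  refine le_trans ?_ this
  refine Finset.card_le_card_of_injOn (fun k => (ZMod.stdAddChar k : ℂ)) (fun k hk => ?_)
    fun a _ b _ h => ZMod.injective_stdAddChar h
  simp only [Finset.coe_filter, Finset.mem_univ, true_and, Set.mem_ofPred_eq] at hk
  have h1 := zcos_sq_add_zsin_sq k
  rw [hk] at h1
  have h2 : zcos k = 1 ∨ zcos k = -1 := by
    rw [← sq_eq_one_iff]; linarith
  simp only [Finset.coe_insert, Finset.coe_singleton, Set.mem_insert_iff, Set.mem_singleton_iff]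
  rw [stdAddChar_eq, hk]
  rcases h2 with h | h <;> simp [h]

omit [NeZero n] in
lemma sum_inv_Icc_le : ∑ m ∈ Finset.Icc 1 (n - 1), (m : ℝ)⁻¹ ≤ 1 + Real.log n := by
  have h := harmonic_le_one_add_log n
  rw [harmonic_eq_sum_Icc] at h
  push_cast at h
  refine le_trans (Finset.sum_le_sum_of_subset_of_nonneg ?_ fun _ _ _ => by positivity) h
  exact Finset.Icc_subset_Icc_right (by omega)

lemma sum_inv_abs_zsin_le : ∑ k : ZMod n, |zsin k|⁻¹ ≤ 2 * n * (1 + Real.log n) := by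
  have h := sum_abs_zsin_le (n := n) (G := fun t => |t|⁻¹) (by simp) (fun t => by positivity) (by
    intro a ha b hb hab
    simp only [Set.mem_Ioi] at ha hb
    simp only [abs_of_pos ha, abs_of_pos hb]
    exact inv_anti₀ ha hab)
  simp only [abs_abs] at h
  refine h.trans ?_
  have h2 : ∀ m ∈ Finset.Icc 1 (n - 1), |2 * (m : ℝ) / n|⁻¹ = n / 2 * (m : ℝ)⁻¹ := by
    intro m _
    rw [abs_of_nonneg (by positivity), inv_div]
    rw [div_mul_eq_div_div, div_eq_mul_inv]
  rw [Finset.sum_congr rfl h2, ← Finset.mul_sum]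
  have h3 := mul_le_mul_of_nonneg_left (sum_inv_Icc_le (n := n)) (by positivity : (0 : ℝ) ≤ n / 2)
  linarith

/-- The logarithm is a harmless loss: this is used only for the at most two `l` with `zsin l = 0`.
-/
lemma sum_inv_zsin_sq_le : ∑ k : ZMod n, (zsin k ^ 2)⁻¹ ≤ (n : ℝ) ^ 2 * (1 + Real.log n) := by
  have hn : (0 : ℝ) < n := Nat.cast_pos.mpr (NeZero.pos n)
  have h1 : ∀ k : ZMod n, (zsin k ^ 2)⁻¹ ≤ n / 2 * |zsin k|⁻¹ := by
    intro k
    by_cases hk : zsin k = 0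
    · simp [hk]
    · have h2 := two_div_le_abs_zsin hk
      have h3 : 0 < |zsin k| := abs_pos.mpr hk
      rw [← sq_abs, sq, mul_inv]
      refine mul_le_mul_of_nonneg_right ?_ (by positivity)
      rw [← inv_div]
      exact inv_anti₀ (by positivity) h2
  refine (Finset.sum_le_sum fun k _ => h1 k).trans ?_
  rw [← Finset.mul_sum]
  calc _ ≤ n / 2 * (2 * n * (1 + Real.log n)) :=
        mul_le_mul_of_nonneg_left sum_inv_abs_zsin_le (by positivity)
    _ = _ := by ring

/-- The denominator is at least half of `(|zsin k| + s) ^ 2`, whose inverses sum like an integral.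
The at most two `k` of zero sine add the fifth `n * s⁻¹`. -/
lemma sum_inv_zsin_sq_add_sq_le {s : ℝ} (hs : 2 / (n : ℝ) ≤ s) :
    ∑ k : ZMod n, (zsin k ^ 2 + s ^ 2)⁻¹ ≤ 5 * n * s⁻¹ := by
  classical
  have hn : (0 : ℝ) < n := Nat.cast_pos.mpr (NeZero.pos n)
  have hs0 : 0 < s := lt_of_lt_of_le (by positivity) hs
  set G : ℝ → ℝ := fun t => if t = 0 then 0 else 2 * ((s + t) ^ 2)⁻¹ with hG
  have h := sum_abs_zsin_le (n := n) (G := G) (by simp [hG])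
    (fun t => by simp only [hG]; split_ifs <;> positivity) (by
      intro a ha b hb hab
      rw [Set.mem_Ioi] at ha hb
      simp only [hG, if_neg ha.ne', if_neg hb.ne']
      gcongr)
  have h1 : ∀ k : ZMod n, (zsin k ^ 2 + s ^ 2)⁻¹ ≤
      G |zsin k| + if zsin k = 0 then (s ^ 2)⁻¹ else 0 := by
    intro k
    by_cases hk : zsin k = 0
    · simp [hk, hG]
    · have h3 : 0 < |zsin k| := abs_pos.mpr hk
      simp only [hG, if_neg hk, if_neg h3.ne', add_zero]
      rw [← sq_abs (zsin k), ← div_eq_mul_inv, inv_eq_one_div,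
        div_le_div_iff₀ (by positivity) (by positivity)]
      nlinarith [sq_nonneg (s - |zsin k|)]
  have h2 : ∑ m ∈ Finset.Icc 1 (n - 1), G (2 * m / n) ≤ 2 * (2 / (n : ℝ) * s)⁻¹ := by
    refine le_trans ?_ (mul_le_mul_of_nonneg_left (sum_inv_add_mul_sq_le hs0
      (by positivity : 0 < 2 / (n : ℝ)) (n - 1)) (by norm_num))
    rw [Finset.mul_sum]
    refine Finset.sum_le_sum fun m _ => ?_
    simp only [hG]
    split_ifs
    · positivity
    · rw [div_mul_eq_mul_div]
  have h4 : ∑ k : ZMod n, (if zsin k = 0 then (s ^ 2)⁻¹ else 0) ≤ 2 * (s ^ 2)⁻¹ := by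
    rw [← Finset.sum_filter, Finset.sum_const, nsmul_eq_mul]
    refine mul_le_mul_of_nonneg_right ?_ (by positivity)
    exact_mod_cast card_zsin_eq_zero_le
  have h5 : 2 * (s ^ 2)⁻¹ ≤ n * s⁻¹ := by
    rw [sq, mul_inv, ← mul_assoc]
    refine mul_le_mul_of_nonneg_right ?_ (by positivity)
    rw [div_le_iff₀ hn] at hs
    rw [← div_eq_mul_inv, div_le_iff₀ hs0]
    linarith
  have h6 : 4 * (2 * (2 / (n : ℝ) * s)⁻¹) = 4 * n * s⁻¹ := by field_simp
  have h7 := Finset.sum_le_sum fun k (_ : k ∈ Finset.univ) => h1 k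
  rw [Finset.sum_add_distrib] at h7
  linarith

lemma sum_inv_two_sub_le : ∑ l : ZMod n, ∑ k : ZMod n, (2 - 2 * (zcos k * zcos l))⁻¹ ≤
    13 * (n : ℝ) ^ 2 * (1 + Real.log n) := by
  classical
  have hn : (1 : ℝ) ≤ n := by exact_mod_cast NeZero.one_le (n := n)
  have hlog : 0 ≤ Real.log n := Real.log_nonneg hn
  have h1 : ∀ l : ZMod n, ∑ k : ZMod n, (2 - 2 * (zcos k * zcos l))⁻¹ ≤ 5 * n * |zsin l|⁻¹ +
      if zsin l = 0 then n / 4 + (n : ℝ) ^ 2 * (1 + Real.log n) else 0 := by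
    intro l
    by_cases hl : zsin l = 0
    · have h2 : ∀ k : ZMod n, (2 - 2 * (zcos k * zcos l))⁻¹ ≤ 1 / 4 + (zsin k ^ 2)⁻¹ := by
        intro k
        by_cases hk : zsin k = 0
        · exact (inv_two_sub_le_quarter hk hl).trans (le_add_of_nonneg_right (by positivity))
        · have := inv_two_sub_le_inv (k := l) hk
          rw [hl, mul_comm (zcos l)] at this
          refine this.trans ?_
          norm_num
      rw [if_pos hl, hl, abs_zero, inv_zero, mul_zero, zero_add]
      refine (Finset.sum_le_sum fun k _ => h2 k).trans ?_
      rw [Finset.sum_add_distrib, Finset.sum_const, Finset.card_univ, ZMod.card, nsmul_eq_mul]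
      have := sum_inv_zsin_sq_le (n := n)
      linarith
    · rw [if_neg hl, add_zero]
      refine (Finset.sum_le_sum fun k _ => inv_two_sub_le_inv hl).trans ?_
      have := sum_inv_zsin_sq_add_sq_le (two_div_le_abs_zsin hl)
      rwa [sq_abs] at this
  refine (Finset.sum_le_sum fun l _ => h1 l).trans ?_
  rw [Finset.sum_add_distrib, ← Finset.mul_sum, ← Finset.sum_filter, Finset.sum_const,
    nsmul_eq_mul]
  have h3 := mul_le_mul_of_nonneg_left (sum_inv_abs_zsin_le (n := n))
    (by positivity : (0 : ℝ) ≤ 5 * n)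
  have h4 : ((Finset.univ.filter fun k : ZMod n => zsin k = 0).card : ℝ) *
      (n / 4 + (n : ℝ) ^ 2 * (1 + Real.log n)) ≤
      2 * (n / 4 + (n : ℝ) ^ 2 * (1 + Real.log n)) := by
    refine mul_le_mul_of_nonneg_right ?_ (by positivity)
    exact_mod_cast card_zsin_eq_zero_le
  have h5 : (n : ℝ) ≤ (n : ℝ) ^ 2 * (1 + Real.log n) := by nlinarith
  nlinarith

/-- The sum `∑ (1 + cos (2 π (k x + l y) / n)) / (2 - 2 cos θ_k cos θ_l)`. -/
def greenSum (n : ℕ) [NeZero n] (x y : ℕ) : ℝ := ∑ l : ZMod n, ∑ k : ZMod n,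
  (1 + zcos (k * (x : ZMod n) + l * (y : ZMod n))) * (2 - 2 * (zcos k * zcos l))⁻¹

lemma greenSum_comm (x y : ℕ) : greenSum n x y = greenSum n y x := by
  rw [greenSum, greenSum, Finset.sum_comm]
  refine Finset.sum_congr rfl fun l _ => Finset.sum_congr rfl fun k _ => ?_
  rw [add_comm (l * _), mul_comm (zcos l)]

lemma abs_zcos_le_one (k : ZMod n) : |zcos k| ≤ 1 := by
  rw [← sq_le_one_iff_abs_le_one]; nlinarith [zcos_sq_add_zsin_sq k, sq_nonneg (zsin k)]

lemma inv_two_sub_nonneg (k l : ZMod n) : 0 ≤ (2 - 2 * (zcos k * zcos l))⁻¹ :=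
  inv_nonneg.mpr (by linarith [zcos_mul_zcos_le_one k l])

lemma greenSum_le (x y : ℕ) : greenSum n x y ≤ 26 * (n : ℝ) ^ 2 * (1 + Real.log n) := by
  have h : greenSum n x y ≤
      2 * ∑ l : ZMod n, ∑ k : ZMod n, (2 - 2 * (zcos k * zcos l))⁻¹ := by
    simp only [Finset.mul_sum]
    refine Finset.sum_le_sum fun l _ => Finset.sum_le_sum fun k _ => ?_
    refine mul_le_mul_of_nonneg_right ?_ (inv_two_sub_nonneg k l)
    linarith [le_of_abs_le (abs_zcos_le_one (k * (x : ZMod n) + l * (y : ZMod n)))]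
  have := sum_inv_two_sub_le (n := n)
  linarith

/-- The Dirichlet kernel bound, by telescoping. -/
lemma abs_sin_mul_sum_cos_le (α β : ℝ) (m : ℕ) :
    |Real.sin (α / 2)| * |∑ k ∈ Finset.range m, Real.cos (k * α + β)| ≤ 1 := by
  have h : 2 * (Real.sin (α / 2) * ∑ k ∈ Finset.range m, Real.cos (k * α + β)) =
      Real.sin (m * α + β - α / 2) - Real.sin (β - α / 2) := by
    induction m with
    | zero => simp
    | succ m ih =>
      rw [Finset.sum_range_succ, mul_add, mul_add, ih]
      have e1 : ((m + 1 : ℕ) : ℝ) * α + β - α / 2 = (m * α + β) + α / 2 := by push_cast; ring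
      rw [e1, Real.sin_add, Real.sin_sub (m * α + β)]
      ring
  rw [← abs_mul, abs_le]
  have h1 := Real.neg_one_le_sin (m * α + β - α / 2)
  have h2 := Real.sin_le_one (m * α + β - α / 2)
  have h3 := Real.neg_one_le_sin (β - α / 2)
  have h4 := Real.sin_le_one (β - α / 2)
  constructor <;> linarith

lemma log_sub_log_le_sum {a b : ℕ} (ha : 1 ≤ a) (hab : a ≤ b) :
    Real.log b - Real.log a ≤ ∑ l ∈ Finset.Ico a b, (l : ℝ)⁻¹ := by
  induction b, hab using Nat.le_induction with
  | base => simp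
  | succ b hb ih =>
    rw [Finset.sum_Ico_succ_top hb]
    have hb0 : (0 : ℝ) < b := by exact_mod_cast (by omega : 0 < b)
    have h1 : Real.log (b + 1 : ℕ) - Real.log b ≤ (b : ℝ)⁻¹ := by
      push_cast
      rw [← Real.log_div (by positivity) (by positivity)]
      refine (Real.log_le_sub_one_of_pos (by positivity)).trans (le_of_eq ?_)
      field_simp
      ring
    linarith

lemma two_mul_cyc_div_le_sin {x : ℕ} (hx : x ≤ n) :
    2 * (cyc n x : ℝ) / n ≤ Real.sin (Real.pi * x / n) := by
  rcases Nat.lt_or_ge n (2 * x) with h | h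
  · rw [← sin_pi_mul_div_sub hx, show cyc n x = n - x by unfold cyc; omega]
    exact two_mul_div_le_sin (by omega)
  · rw [show cyc n x = x by unfold cyc; omega]
    exact two_mul_div_le_sin h

/-- The contribution of the frequencies `k ≤ l` for a fixed `l`. -/
lemma inv_le_sum_range {x y l : ℕ} (hxn : x ≤ n) (hl0 : 0 < l) (hln : 2 * l < n)
    (hlx : n ≤ l * cyc n x) : (n : ℝ) ^ 2 / (16 * Real.pi ^ 2) * (l : ℝ)⁻¹ ≤
      ∑ k ∈ Finset.range (l + 1),
        (1 + zcos ((k : ZMod n) * (x : ZMod n) + (l : ZMod n) * (y : ZMod n))) *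
          (2 - 2 * (zcos (k : ZMod n) * zcos (l : ZMod n)))⁻¹ := by
  have hn : (0 : ℝ) < n := Nat.cast_pos.mpr (NeZero.pos n)
  have hl : (0 : ℝ) < l := by exact_mod_cast hl0
  have hpi := Real.pi_pos
  have h1 : ∀ k ∈ Finset.range (l + 1), (n : ℝ) ^ 2 / (8 * Real.pi ^ 2 * l ^ 2) ≤
      (2 - 2 * (zcos (k : ZMod n) * zcos (l : ZMod n)))⁻¹ := by
    intro k hk
    have hkl : (k : ℝ) ≤ l := by
      exact_mod_cast (by simpa [Nat.lt_succ_iff] using hk : k ≤ l)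
    rw [zcos_natCast, zcos_natCast]
    set a := 2 * Real.pi * k / n with ha
    set b := 2 * Real.pi * l / n with hb
    have hb0 : 0 < b := by positivity
    have hbpi : b < Real.pi := by
      rw [hb, div_lt_iff₀ hn]
      have : (2 * l : ℝ) < n := by exact_mod_cast hln
      nlinarith
    have ha0 : 0 ≤ a := by positivity
    have hab : a ≤ b := by rw [ha, hb]; gcongr
    have hc1 : Real.cos b < 1 := by
      rw [← Real.cos_zero]
      exact Real.cos_lt_cos_of_nonneg_of_le_pi le_rfl hbpi.le hb0
    have hc2 : -1 < Real.cos b := by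
      rw [← Real.cos_pi]
      exact Real.cos_lt_cos_of_nonneg_of_le_pi hb0.le le_rfl hbpi
    have hpos : 0 < 2 - 2 * (Real.cos a * Real.cos b) := by
      have e1 : |Real.cos a * Real.cos b| < 1 := by
        rw [abs_mul]
        calc |Real.cos a| * |Real.cos b| ≤ 1 * |Real.cos b| :=
              mul_le_mul_of_nonneg_right (Real.abs_cos_le_one a) (abs_nonneg _)
          _ < 1 := by rw [one_mul, abs_lt]; exact ⟨hc2, hc1⟩
      linarith [le_abs_self (Real.cos a * Real.cos b)]
    -- Twice the product of cosines is `cos (a + b) + cos (a - b)`, so the left side is at most `a ^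
    -- 2 + b ^ 2`.
    have hup : 2 - 2 * (Real.cos a * Real.cos b) ≤ 2 * b ^ 2 := by
      have e1 := Real.one_sub_sq_div_two_le_cos (x := a + b)
      have e2 := Real.one_sub_sq_div_two_le_cos (x := a - b)
      rw [Real.cos_add] at e1
      rw [Real.cos_sub] at e2
      nlinarith
    rw [show (n : ℝ) ^ 2 / (8 * Real.pi ^ 2 * l ^ 2) = (2 * b ^ 2)⁻¹ by
      rw [hb]; field_simp; norm_num]
    exact inv_anti₀ hpos hup
  have h2 : (l : ℝ) / 2 ≤ ∑ k ∈ Finset.range (l + 1),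
      (1 + zcos ((k : ZMod n) * (x : ZMod n) + (l : ZMod n) * (y : ZMod n))) := by
    have e1 : ∀ k ∈ Finset.range (l + 1),
        zcos ((k : ZMod n) * (x : ZMod n) + (l : ZMod n) * (y : ZMod n)) =
        Real.cos (k * (2 * Real.pi * x / n) + 2 * Real.pi * (l * y) / n) := by
      intro k _
      rw [← Nat.cast_mul, ← Nat.cast_mul, ← Nat.cast_add, zcos_natCast]
      congr 1
      push_cast
      ring
    rw [Finset.sum_add_distrib, Finset.sum_congr rfl e1]
    have e2 := abs_sin_mul_sum_cos_le (2 * Real.pi * x / n) (2 * Real.pi * (l * y) / n) (l + 1)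
    set S := ∑ k ∈ Finset.range (l + 1),
      Real.cos (k * (2 * Real.pi * x / n) + 2 * Real.pi * (l * y) / n)
    rw [show 2 * Real.pi * (x : ℝ) / n / 2 = Real.pi * x / n by ring] at e2
    -- The condition `n ≤ l * cyc n x` lets the cosine sum cancel at most half of the `l + 1` ones.
    have e3 : 2 / (l : ℝ) ≤ Real.sin (Real.pi * x / n) := by
      refine le_trans ?_ (two_mul_cyc_div_le_sin hxn)
      rw [div_le_div_iff₀ hl hn]
      have : (n : ℝ) ≤ l * cyc n x := by exact_mod_cast hlx
      linarith
    have e4 : 2 / (l : ℝ) * |S| ≤ 1 :=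
      le_trans (mul_le_mul_of_nonneg_right (e3.trans (le_abs_self _)) (abs_nonneg _)) e2
    have e5 : |S| ≤ l / 2 := by
      rw [div_mul_eq_mul_div, div_le_one hl] at e4
      linarith
    simp only [Finset.sum_const, Finset.card_range, nsmul_eq_mul, mul_one]
    push_cast
    linarith [neg_abs_le S]
  calc (n : ℝ) ^ 2 / (16 * Real.pi ^ 2) * (l : ℝ)⁻¹
      = l / 2 * ((n : ℝ) ^ 2 / (8 * Real.pi ^ 2 * l ^ 2)) := by field_simp; norm_num
    _ ≤ (∑ k ∈ Finset.range (l + 1),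
      (1 + zcos ((k : ZMod n) * (x : ZMod n) + (l : ZMod n) * (y : ZMod n)))) *
        ((n : ℝ) ^ 2 / (8 * Real.pi ^ 2 * l ^ 2)) :=
      mul_le_mul_of_nonneg_right h2 (by positivity)
    _ ≤ _ := by
      rw [Finset.sum_mul]
      refine Finset.sum_le_sum fun k hk => mul_le_mul_of_nonneg_left (h1 k hk) ?_
      linarith [neg_le_of_abs_le
        (abs_zcos_le_one ((k : ZMod n) * (x : ZMod n) + (l : ZMod n) * (y : ZMod n)))]

/-- All terms are nonnegative, so the wedge `k ≤ l` with `√n < l < n/2` suffices. There `n ≤ l * cyc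
n x`, each `l` contributes order `n²/l`, and the harmonic sum over this range is of order `log n`.
-/
lemma le_greenSum_of_le_cyc_sq {x : ℕ} (y : ℕ) (hn : 256 ≤ n) (hxn : x ≤ n)
    (hx : n ≤ cyc n x ^ 2) :
    (n : ℝ) ^ 2 / (64 * Real.pi ^ 2) * Real.log n ≤ greenSum n x y := by
  have hn' : (256 : ℝ) ≤ n := by exact_mod_cast hn
  set a := Nat.sqrt n + 1 with ha
  set b := (n + 1) / 2 with hb
  have hsq : n < a * a := Nat.lt_succ_sqrt n
  have hsn : Nat.sqrt n * Nat.sqrt n ≤ n := Nat.sqrt_le n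
  have h16 : 16 ≤ Nat.sqrt n := Nat.le_sqrt.mpr (by omega)
  have hab : a ≤ b := by
    have : 16 * Nat.sqrt n ≤ n := le_trans (Nat.mul_le_mul_right _ h16) hsn
    omega
  set f : ZMod n → ZMod n → ℝ := fun k l =>
    (1 + zcos (k * (x : ZMod n) + l * (y : ZMod n))) * (2 - 2 * (zcos k * zcos l))⁻¹ with hf
  have hf0 : ∀ k l, 0 ≤ f k l := fun k l => mul_nonneg (by
    linarith [neg_le_of_abs_le (abs_zcos_le_one (k * (x : ZMod n) + l * (y : ZMod n)))])
      (inv_two_sub_nonneg k l)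
  have h1 : ∑ l ∈ Finset.Ico a b, ∑ k ∈ Finset.range (l + 1), f (k : ZMod n) (l : ZMod n) ≤
      greenSum n x y := by
    rw [greenSum, ← sum_range_natCast]
    refine le_trans (Finset.sum_le_sum fun l hl => ?_) (Finset.sum_le_sum_of_subset_of_nonneg
      (s := Finset.Ico a b) ?_ fun l _ _ => Finset.sum_nonneg fun k _ => hf0 k l)
    · change _ ≤ ∑ k : ZMod n, f k l
      rw [← sum_range_natCast (fun k => f k l)]
      refine Finset.sum_le_sum_of_subset_of_nonneg ?_ fun k _ _ => hf0 k l
      intro k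
      simp only [Finset.mem_Ico, Finset.mem_range] at hl ⊢
      omega
    · intro l
      simp only [Finset.mem_Ico, Finset.mem_range]
      omega
  refine le_trans ?_ h1
  have h2 : ∑ l ∈ Finset.Ico a b, (n : ℝ) ^ 2 / (16 * Real.pi ^ 2) * (l : ℝ)⁻¹ ≤
      ∑ l ∈ Finset.Ico a b, ∑ k ∈ Finset.range (l + 1), f (k : ZMod n) (l : ZMod n) := by
    refine Finset.sum_le_sum fun l hl => inv_le_sum_range hxn ?_ ?_ ?_
    · simp only [Finset.mem_Ico] at hl; omega
    · simp only [Finset.mem_Ico] at hl; omega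
    · have hal : a ≤ l := (Finset.mem_Ico.mp hl).1
      have : n * n ≤ (l * cyc n x) * (l * cyc n x) := by
        calc n * n ≤ (a * a) * (cyc n x ^ 2) := Nat.mul_le_mul hsq.le hx
          _ ≤ (l * l) * (cyc n x ^ 2) := Nat.mul_le_mul_right _ (Nat.mul_le_mul hal hal)
          _ = _ := by ring
      exact Nat.mul_self_le_mul_self_iff.mp this
  refine le_trans ?_ h2
  rw [← Finset.mul_sum]
  have h3 := log_sub_log_le_sum (by omega : 1 ≤ a) hab
  have h4 : Real.log n / 4 ≤ Real.log b - Real.log a := by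
    have hn0 : (0 : ℝ) < n := by linarith
    have ha0 : (0 : ℝ) < a := by exact_mod_cast (by omega : 0 < a)
    have hb0 : (0 : ℝ) < b := by exact_mod_cast (by omega : 0 < b)
    have e1 : (n : ℝ) ≤ 2 * b := by exact_mod_cast (by omega : n ≤ 2 * b)
    have e2 : (a : ℝ) ^ 2 ≤ 4 * n := by
      have : a * a ≤ 4 * n := by rw [ha]; nlinarith
      rw [sq]; exact_mod_cast this
    -- With `a ≤ 2√n` and `b ≥ n/2` this reduces to `16 n³ ≤ n⁴/16`, the origin of `256 ≤ n`.
    have e3 : (n : ℝ) * a ^ 4 ≤ (b : ℝ) ^ 4 := by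
      calc (n : ℝ) * a ^ 4 = n * (a ^ 2) ^ 2 := by ring
        _ ≤ (n : ℝ) * (4 * n) ^ 2 := by gcongr
        _ = 16 * (n : ℝ) ^ 3 := by ring
        _ ≤ (n : ℝ) ^ 4 / 16 := by nlinarith [pow_pos hn0 3]
        _ ≤ (2 * b : ℝ) ^ 4 / 16 := by gcongr
        _ = _ := by ring
    have e4 := Real.log_le_log (by positivity) e3
    rw [Real.log_mul (by positivity) (by positivity), Real.log_pow, Real.log_pow] at e4
    push_cast at e4
    linarith
  calc (n : ℝ) ^ 2 / (64 * Real.pi ^ 2) * Real.log n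
      = (n : ℝ) ^ 2 / (16 * Real.pi ^ 2) * (Real.log n / 4) := by ring
    _ ≤ _ := mul_le_mul_of_nonneg_left (h4.trans h3) (by positivity)

lemma le_greenSum {x y : ℕ} (hn : 256 ≤ n) (hxn : x ≤ n) (hyn : y ≤ n)
    (hxy : n ≤ cyc n x * cyc n y) :
    (n : ℝ) ^ 2 / (64 * Real.pi ^ 2) * Real.log n ≤ greenSum n x y := by
  rcases le_total (cyc n x) (cyc n y) with h | h
  · rw [greenSum_comm]
    refine le_greenSum_of_le_cyc_sq x hn hyn (hxy.trans ?_)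
    rw [sq]
    exact Nat.mul_le_mul_right _ h
  · refine le_greenSum_of_le_cyc_sq y hn hxn (hxy.trans ?_)
    rw [sq]
    exact Nat.mul_le_mul_left _ h

end EnergyBounds

/-! ### Success probability and hitting time when the product of the distances is at least n. -/

section Optimality

variable {n : ℕ} [NeZero n]

omit [NeZero n] in
lemma natCast_vertex_ne_zero {x y : ℕ} (hx0 : 0 < x) (hxn : x < n) :
    ((x : ZMod n), (y : ZMod n)) ≠ (0 : Vertex n) := by
  intro h
  have h1 : (x : ZMod n) = 0 := congrArg Prod.fst h
  rw [ZMod.natCast_eq_zero_iff] at h1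
  exact absurd (Nat.le_of_dvd hx0 h1) (by omega)

lemma energy_markedCoeff (x y : ℕ) :
    energy (fun k : Vertex n => zcos k.1 * zcos k.2)
      (markedCoeff ((x : ZMod n), (y : ZMod n))) = greenSum n x y / (n : ℝ) ^ 2 := by
  rw [energy, greenSum, Finset.sum_comm, Finset.sum_div, Fintype.sum_prod_type]
  refine Finset.sum_congr rfl fun k _ => ?_
  rw [Finset.sum_div]
  refine Finset.sum_congr rfl fun l _ => ?_
  rw [norm_markedCoeff_sq]
  ring

/-- A fixed mode needs both sines zero: at most four modes, each of weight at most `2 / n²`. -/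
lemma fixedWeight_markedCoeff_le (m : Vertex n) :
    fixedWeight (fun k : Vertex n => zcos k.1 * zcos k.2) (markedCoeff m) ≤ 8 / (n : ℝ) ^ 2 := by
  classical
  set Z := Finset.univ.filter fun k : ZMod n => zsin k = 0 with hZ
  have h1 : ∀ k : Vertex n, zcos k.1 * zcos k.2 = 1 → zsin k.1 = 0 ∧ zsin k.2 = 0 := by
    intro k hk
    have h := zsin_sq_add_zsin_sq_le k.1 k.2
    rw [hk] at h
    constructor <;> nlinarith [sq_nonneg (zsin k.1), sq_nonneg (zsin k.2)]
  have h2 : fixedWeight (fun k : Vertex n => zcos k.1 * zcos k.2) (markedCoeff m) ≤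
      ∑ k ∈ Z ×ˢ Z, 2 / (n : ℝ) ^ 2 := by
    rw [fixedWeight, ← Finset.sum_filter]
    refine (Finset.sum_le_sum_of_subset_of_nonneg (t := Z ×ˢ Z) (fun k hk => ?_)
      fun _ _ _ => by positivity).trans (Finset.sum_le_sum fun k _ => ?_)
    · rw [Finset.mem_filter] at hk
      rw [Finset.mem_product, hZ, Finset.mem_filter, Finset.mem_filter]
      exact ⟨⟨Finset.mem_univ _, (h1 k hk.2).1⟩, Finset.mem_univ _, (h1 k hk.2).2⟩
    · rw [norm_markedCoeff_sq]
      gcongr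
      linarith [le_of_abs_le (abs_zcos_le_one (k.1 * m.1 + k.2 * m.2))]
  refine h2.trans ?_
  rw [Finset.sum_const, Finset.card_product, nsmul_eq_mul, Nat.cast_mul]
  have h3 : (Z.card : ℝ) ≤ 2 := by exact_mod_cast card_zsin_eq_zero_le
  calc (Z.card : ℝ) * Z.card * (2 / (n : ℝ) ^ 2) ≤ 2 * 2 * (2 / (n : ℝ) ^ 2) := by gcongr
    _ = _ := by ring

/-- The squared coefficient is `(1 + cos) / n²`; the part from the 1 is odd in a frequency and sums
to zero, so only the interference between the vertices survives. -/
lemma asymmetry_markedCoeff (x y : ℕ) :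
    asymmetry (fun k : Vertex n => zcos k.1 * zcos k.2) (fun k => zsin k.1 * zsin k.2)
      (markedCoeff ((x : ZMod n), (y : ZMod n))) = -2 * interference n x y / (n : ℝ) ^ 2 := by
  have h1 : ∑ l : ZMod n, ∑ k : ZMod n, zsin k * zsin l / (1 - zcos k * zcos l) = 0 :=
    Finset.sum_eq_zero fun l _ => sum_zmod_eq_zero_of_odd fun k => by
      rw [zcos_neg, zsin_neg]; ring
  rw [Finset.sum_comm] at h1
  have h2 : -2 * interference n x y = ∑ k : ZMod n, ∑ l : ZMod n,
      zcos (k * (x : ZMod n) + l * (y : ZMod n)) * (zsin k * zsin l / (1 - zcos k * zcos l)) := by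
    rw [interference_eq_sum]; ring
  rw [h2, asymmetry, Fintype.sum_prod_type, ← zero_add (∑ k : ZMod n, ∑ l : ZMod n, zcos _ * _),
    ← h1, ← Finset.sum_add_distrib, Finset.sum_div]
  refine Finset.sum_congr rfl fun k _ => ?_
  rw [← Finset.sum_add_distrib, Finset.sum_div]
  refine Finset.sum_congr rfl fun l _ => ?_
  rw [norm_markedCoeff_sq]
  ring

section Orbit

variable (m : Vertex n)

lemma walkIso_searchState_zero : walkIso n (searchState m 0) = searchState m 0 := by
  rw [searchState_zero]
  exact diagWave_isBlockFamily.map_eq_self (by simp [zcos_zero])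

lemma norm_searchState_zero : ‖searchState m 0‖ = 1 := by
  rw [searchState_zero]
  exact diagWave_isBlockFamily.orthonormal.norm_eq_one 0

variable {m}

lemma successProb_le_one (hm : m ≠ 0) (t : ℕ) : successProb n {0, m} t ≤ 1 := by
  rw [successProb_eq hm]
  have h := norm_inner_le_norm (𝕜 := ℂ) (markedVec m) (searchState m t)
  rw [norm_markedVec hm, norm_orbit (U := walkIso n) (norm_markedVec hm) (searchState_succ hm),
    norm_searchState_zero, mul_one] at h
  exact pow_le_one₀ (norm_nonneg _) h

lemma energy_mul_successProb_le (hm : m ≠ 0) (t : ℕ) :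
    energy (fun k : Vertex n => zcos k.1 * zcos k.2) (markedCoeff m) * successProb n {0, m} t ≤
      9 / 4 := by
  have hn : (0 : ℝ) < n := Nat.cast_pos.mpr (NeZero.pos n)
  have hw := norm_markedVec hm
  have hψ := searchState_succ hm
  have hε := inner_markedVec_searchState_zero m
  rw [successProb_eq hm]
  rw [markedVec_eq] at hw hψ hε ⊢
  have h := diagWave_isBlockFamily.overlap_le hw (walkIso_searchState_zero m)
    (norm_searchState_zero m) hψ (fun k => zcos_mul_zcos_le_one _ _)
    (fun k => inv_two_sub_le k.1 k.2) (by positivity) t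
  rw [hε] at h
  have h1 : Real.sqrt ((n : ℝ) ^ 2 / 4) = n / 2 := by
    rw [show (n : ℝ) ^ 2 / 4 = (n / 2) ^ 2 by ring, Real.sqrt_sq (by positivity)]
  -- The initial overlap exactly balances the square root of the gap bound `n² / 4`.
  have h2 : 1 + 2 * (Real.sqrt 2 / n) * (n / 2) = 1 + Real.sqrt 2 := by field_simp
  rw [h1, h2] at h
  have h3 : Real.sqrt 2 ≤ 2 := by rw [Real.sqrt_le_left (by norm_num)]; norm_num
  set A := energy (fun k : Vertex n => zcos k.1 * zcos k.2) (markedCoeff m)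
  set a := ‖inner ℂ (∑ k, markedCoeff m k • diagWave k) (searchState m t)‖
  have hA : 0 ≤ A := Finset.sum_nonneg fun k _ =>
    mul_nonneg (by positivity) (inv_two_sub_nonneg _ _)
  have h4 : (2 * Real.sqrt A * a) ^ 2 ≤ 3 ^ 2 :=
    pow_le_pow_left₀ (by positivity) (h.trans (by linarith)) 2
  rw [mul_pow, mul_pow, Real.sq_sqrt hA] at h4
  linarith

lemma time_le_of_successProb_le (hm : m ≠ 0) {η : ℝ} (hη0 : 0 ≤ η) (T : ℕ)
    (hη : ∀ t < T, successProb n {0, m} t ≤ η ^ 2) :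
    T * (Real.sqrt 2 / n) ≤
      Real.sqrt (energy (fun k : Vertex n => zcos k.1 * zcos k.2) (markedCoeff m)) +
      T * (2 * (8 / (n : ℝ) ^ 2) * T * η + (8 / (n : ℝ) ^ 2 +
        |asymmetry (fun k : Vertex n => zcos k.1 * zcos k.2) (fun k => zsin k.1 * zsin k.2)
          (markedCoeff m)|) * η) := by
  have hw := norm_markedVec hm
  have hψ := searchState_succ hm
  have hε := inner_markedVec_searchState_zero m
  have hη' : ∀ t < T, ‖inner ℂ (markedVec m) (searchState m t)‖ ≤ η := fun t ht =>
    (sq_le_sq₀ (norm_nonneg _) hη0).mp (by rw [← successProb_eq hm]; exact hη t ht)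
  rw [markedVec_eq] at hw hψ hε
  simp only [markedVec_eq] at hη'
  have h := diagWave_isBlockFamily.time_mul_overlap_le hw (walkIso_searchState_zero m)
    (norm_searchState_zero m) hψ T hη'
  rw [hε] at h
  refine h.trans ?_
  have := fixedWeight_markedCoeff_le m
  gcongr

end Orbit

/-- Optimality in terms of one early time with a large success probability. -/
lemma isOptimal_of_exists {c C K : ℝ} {x y : ℕ}
    (h1 : ∃ t : ℕ, (t : ℝ) ≤ K * Real.sqrt ((n : ℝ) ^ 2 * Real.log ((n : ℝ) ^ 2)) ∧
      c / Real.log ((n : ℝ) ^ 2) ≤ successProb n (marked n x y) t)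
    (h2 : ∀ s : ℕ, successProb n (marked n x y) s ≤ C / Real.log ((n : ℝ) ^ 2)) :
    IsOptimal c C K n x y := by
  refine ⟨?_, h2⟩
  obtain ⟨t, ht, hct⟩ := h1
  set B := K * Real.sqrt ((n : ℝ) ^ 2 * Real.log ((n : ℝ) ^ 2))
  have hB : 0 ≤ B := (Nat.cast_nonneg t).trans ht
  have hmem : ∀ s : ℕ, s ∈ Finset.range (⌊B⌋₊ + 1) ↔ (s : ℝ) ≤ B := fun s => by
    rw [Finset.mem_range, Nat.lt_succ_iff, Nat.le_floor_iff hB]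
  obtain ⟨t', ht', hmax⟩ := Finset.exists_max_image (Finset.range (⌊B⌋₊ + 1))
    (fun s => successProb n (marked n x y) s) ⟨t, (hmem t).mpr ht⟩
  exact ⟨t', (hmem t').mp ht', fun s hs => hmax s ((hmem s).mpr hs),
    hct.trans (hmax t ((hmem t).mpr ht))⟩

variable {x y : ℕ}

lemma pos_of_le_cyc_mul_cyc (h : n ≤ cyc n x * cyc n y) : 0 < x ∧ 0 < y ∧ 4 ≤ n := by
  have hn : 0 < n := NeZero.pos n
  have hx : 2 * cyc n x ≤ n := by unfold cyc; omega
  have hy : 2 * cyc n y ≤ n := by unfold cyc; omega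
  have h1 : 0 < cyc n x := Nat.pos_of_ne_zero fun h0 => by rw [h0] at h; omega
  have h2 : 0 < cyc n y := Nat.pos_of_ne_zero fun h0 => by rw [h0] at h; omega
  refine ⟨?_, ?_, ?_⟩
  · unfold cyc at h1; omega
  · unfold cyc at h2; omega
  · have : 4 * n ≤ n * n := by nlinarith
    exact Nat.le_of_mul_le_mul_right this hn

omit [NeZero n] in
lemma log_sq_eq : Real.log ((n : ℝ) ^ 2) = 2 * Real.log n := by
  rw [Real.log_pow]; norm_num

omit [NeZero n] in
lemma one_le_log_sq (hn : 2 ≤ n) : 1 ≤ Real.log ((n : ℝ) ^ 2) := by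
  have h1 : Real.log 2 ≤ Real.log n := Real.log_le_log (by norm_num) (by exact_mod_cast hn)
  have := Real.log_two_gt_d9
  rw [log_sq_eq]
  linarith

lemma successProb_le_div_log (hxn : x < n) (hyn : y < n) (hxy : n ≤ cyc n x * cyc n y) (t : ℕ) :
    successProb n (marked n x y) t ≤ 3000 / Real.log ((n : ℝ) ^ 2) := by
  obtain ⟨hx0, -, hn4⟩ := pos_of_le_cyc_mul_cyc hxy
  have hL := one_le_log_sq (n := n) (by omega)
  have hm := natCast_vertex_ne_zero (n := n) (y := y) hx0 hxn
  have hn : (0 : ℝ) < n := Nat.cast_pos.mpr (NeZero.pos n)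
  rw [le_div_iff₀ (by linarith)]
  change successProb n {0, ((x : ZMod n), (y : ZMod n))} t * _ ≤ _
  have hp0 : 0 ≤ successProb n {0, ((x : ZMod n), (y : ZMod n))} t :=
    Finset.sum_nonneg fun _ _ => by positivity
  rcases Nat.lt_or_ge n 256 with h | h
  · have h1 := successProb_le_one hm t
    have h2 : Real.log ((n : ℝ) ^ 2) ≤ 3000 := by
      have h3 := Real.log_le_sub_one_of_pos hn
      have h4 : (n : ℝ) ≤ 256 := by exact_mod_cast h.le
      rw [log_sq_eq]; linarith
    nlinarith
  · have h1 := energy_mul_successProb_le hm t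
    rw [energy_markedCoeff] at h1
    have h2 := le_greenSum h hxn.le hyn.le hxy
    -- From `π² ≤ 10` and `log n² = 2 log n`. Then `1280 * 9 / 4 = 2880`, below 3000.
    have h3 : Real.log ((n : ℝ) ^ 2) / 1280 ≤ greenSum n x y / (n : ℝ) ^ 2 := by
      rw [le_div_iff₀ (by positivity)]
      refine le_trans ?_ h2
      have hpi : Real.pi ^ 2 ≤ 10 := by nlinarith [Real.pi_lt_d2, Real.pi_pos]
      have hlog : 0 ≤ Real.log n := by rw [log_sq_eq] at hL; linarith
      calc Real.log ((n : ℝ) ^ 2) / 1280 * (n : ℝ) ^ 2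
          = (n : ℝ) ^ 2 / (64 * 10) * Real.log n := by rw [log_sq_eq]; ring
        _ ≤ _ := by gcongr
    have h4 := mul_le_mul_of_nonneg_right h3 hp0
    linarith

lemma exists_time_le (hxn : x < n) (hyn : y < n) (hxy : n ≤ cyc n x * cyc n y) :
    ∃ t : ℕ, (t : ℝ) ≤ 16 * Real.sqrt ((n : ℝ) ^ 2 * Real.log ((n : ℝ) ^ 2)) ∧
      (1 / 2568) ^ 2 / Real.log ((n : ℝ) ^ 2) ≤ successProb n (marked n x y) t := by
  obtain ⟨hx0, hy0, hn4⟩ := pos_of_le_cyc_mul_cyc hxy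
  have hL := one_le_log_sq (n := n) (by omega)
  have hm := natCast_vertex_ne_zero (n := n) (y := y) hx0 hxn
  have hn : (4 : ℝ) ≤ n := by exact_mod_cast hn4
  have hn0 : (0 : ℝ) < n := by linarith
  have hA : Real.sqrt (energy (fun k : Vertex n => zcos k.1 * zcos k.2)
      (markedCoeff ((x : ZMod n), (y : ZMod n)))) ≤ 7 * Real.sqrt (Real.log ((n : ℝ) ^ 2)) := by
    rw [energy_markedCoeff]
    refine Real.sqrt_le_left (by positivity) |>.mpr ?_
    rw [mul_pow, Real.sq_sqrt (by linarith), div_le_iff₀ (by positivity)]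
    refine (greenSum_le x y).trans ?_
    rw [log_sq_eq] at hL ⊢
    have : 0 ≤ (n : ℝ) ^ 2 := by positivity
    nlinarith
  have hb : |asymmetry (fun k : Vertex n => zcos k.1 * zcos k.2) (fun k => zsin k.1 * zsin k.2)
      (markedCoeff ((x : ZMod n), (y : ZMod n)))| ≤ 384 / n := by
    rw [asymmetry_markedCoeff, abs_div, abs_mul, abs_of_nonneg (by positivity : 0 ≤ (n : ℝ) ^ 2),
      div_le_iff₀ (by positivity)]
    have h1 := abs_interference_le hx0 hxn hy0 hyn
    have h2 : (n : ℝ) ≤ cyc n x * cyc n y := by exact_mod_cast hxy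
    have h3 : (n : ℝ) ^ 2 / ((cyc n x : ℝ) * (cyc n y : ℝ)) ≤ n := by
      rw [div_le_iff₀ (by linarith), sq]
      exact mul_le_mul_of_nonneg_left h2 hn0.le
    have h4 : 384 / (n : ℝ) * (n : ℝ) ^ 2 = 384 * n := by field_simp
    rw [h4]
    norm_num
    linarith
  have h8 : 8 / (n : ℝ) ^ 2 ≤ 2 / n := by
    rw [div_le_div_iff₀ (by positivity) hn0]
    nlinarith
  rw [Real.sqrt_mul (by positivity), Real.sqrt_sq hn0.le]
  set L := Real.log ((n : ℝ) ^ 2)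
  set r := Real.sqrt L with hr
  have hrL : r ^ 2 = L := Real.sq_sqrt (by linarith)
  have hr1 : 1 ≤ r := Real.one_le_sqrt.mpr hL
  by_contra! hcon
  -- If the success probability were small throughout this window, the drift estimate at its end
  -- would fail.
  set T := ⌊16 * (n * r)⌋₊ with hT
  have hT1 : (T : ℝ) ≤ 16 * (n * r) := Nat.floor_le (by positivity)
  have hT2 : 8 * (n * r) ≤ T := by
    have := Nat.lt_floor_add_one (16 * (n * r))
    have : 1 ≤ n * r := by nlinarith
    linarith
  -- `2568 = 4 * (16 * 16 + 386)`, so the error per step is at most `1 / (4 n)`, against a drift of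
  -- `√2 / n`. The estimate would then give `τ (√2 - 1/4) ≤ 7`, impossible for `τ ≥ 8`.
  set σ : ℝ := 1 / 2568 with hσ
  have h := time_le_of_successProb_le hm (η := σ / r) (by positivity) T (fun t ht => by
    rw [div_pow, hrL]
    refine (hcon t (le_trans ?_ hT1)).le
    exact_mod_cast ht.le)
  set τ := (T : ℝ) / (n * r) with hτ
  have hTτ : (T : ℝ) = τ * (n * r) := by rw [hτ]; field_simp
  have hτ1 : τ ≤ 16 := by rw [hτ, div_le_iff₀ (by positivity)]; exact hT1
  have hτ8 : 8 ≤ τ := by rw [hτ, le_div_iff₀ (by positivity)]; exact hT2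
  have h5 : 2 * (8 / (n : ℝ) ^ 2) * T * (σ / r) + (8 / (n : ℝ) ^ 2 +
      |asymmetry (fun k : Vertex n => zcos k.1 * zcos k.2) (fun k => zsin k.1 * zsin k.2)
        (markedCoeff ((x : ZMod n), (y : ZMod n)))|) * (σ / r) ≤ (16 * 16 + 386) * σ / n := by
    have e1 : 2 * (8 / (n : ℝ) ^ 2) * T * (σ / r) = 16 * τ * σ / n := by
      rw [hTτ]; field_simp; norm_num
    have e2 : (8 / (n : ℝ) ^ 2 +
        |asymmetry (fun k : Vertex n => zcos k.1 * zcos k.2) (fun k => zsin k.1 * zsin k.2)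
          (markedCoeff ((x : ZMod n), (y : ZMod n)))|) * (σ / r) ≤ (386 / n) * σ := by
      refine mul_le_mul ?_ (div_le_self (by positivity) hr1) (by positivity) (by positivity)
      calc _ ≤ 2 / (n : ℝ) + 384 / n := add_le_add h8 hb
        _ = _ := by ring
    have e3 : 16 * τ * σ / n ≤ 16 * 16 * σ / n := by gcongr
    calc _ ≤ 16 * 16 * σ / n + (386 / n) * σ := add_le_add (e1.le.trans e3) e2
      _ = _ := by ring
  have h6 : (T : ℝ) * (Real.sqrt 2 / n) ≤ 7 * r + T * ((16 * 16 + 386) * σ / n) :=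
    h.trans (add_le_add hA (mul_le_mul_of_nonneg_left h5 (by positivity)))
  have h7 : (T : ℝ) * (Real.sqrt 2 / n) = τ * Real.sqrt 2 * r := by
    rw [hTτ]; field_simp
  have h9 : (T : ℝ) * ((16 * 16 + 386) * σ / n) = τ * (1 / 4) * r := by
    rw [hTτ, hσ]; field_simp; norm_num
  rw [h7, h9, ← add_mul] at h6
  have h10 := le_of_mul_le_mul_right h6 (by linarith)
  have h11 : (1.4 : ℝ) ≤ Real.sqrt 2 := Real.le_sqrt_of_sq_le (by norm_num)
  nlinarith

theorem isOptimal (hxn : x < n) (hyn : y < n) (hxy : n ≤ cyc n x * cyc n y) :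
    IsOptimal ((1 / 2568) ^ 2) 3000 16 n x y :=
  isOptimal_of_exists (exists_time_le hxn hyn hxy) (successProb_le_div_log hxn hyn hxy)

end Optimality

/-! ### Counting the exceptional positions. -/

section Counting

lemma card_cyc_le (n M : ℕ) :
    ((Finset.range n).filter fun b => cyc n b ≤ M).card ≤ 2 * M + 1 := by
  have h : (Finset.range n).filter (fun b => cyc n b ≤ M) ⊆
      Finset.range (M + 1) ∪ Finset.Ico (n - M) n := by
    intro b hb
    rw [Finset.mem_filter, Finset.mem_range, cyc] at hb
    rw [Finset.mem_union, Finset.mem_range, Finset.mem_Ico]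
    omega
  refine (Finset.card_le_card h).trans ((Finset.card_union_le _ _).trans ?_)
  rw [Finset.card_range, Nat.card_Ico]
  omega

/-- Bounding the inverse of the minimum by the sum of both inverses turns the later sum over `a`
into two harmonic sums. -/
lemma card_cyc_mul_lt_le {n a : ℕ} (ha0 : 0 < a) (han : a < n) :
    (((Finset.range n).filter fun b => cyc n a * cyc n b < n).card : ℝ) ≤
      3 * n * ((a : ℝ)⁻¹ + ((n - a : ℕ) : ℝ)⁻¹) := by
  have hc0 : 0 < cyc n a := by unfold cyc; omega
  have hcn : cyc n a ≤ n := by unfold cyc; omega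
  have h1 : (Finset.range n).filter (fun b => cyc n a * cyc n b < n) ⊆
      (Finset.range n).filter fun b => cyc n b ≤ n / cyc n a := by
    intro b
    simp only [Finset.mem_filter]
    rintro ⟨hb, h⟩
    refine ⟨hb, (Nat.le_div_iff_mul_le hc0).mpr ?_⟩
    rw [mul_comm]; exact h.le
  have h2 : ((Finset.range n).filter fun b => cyc n a * cyc n b < n).card ≤ 3 * (n / cyc n a) := by
    refine (Finset.card_le_card h1).trans ((card_cyc_le _ _).trans ?_)
    have : 1 ≤ n / cyc n a := (Nat.one_le_div_iff hc0).mpr hcn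
    omega
  have h3 : ((n / cyc n a : ℕ) : ℝ) ≤ n * (cyc n a : ℝ)⁻¹ := by
    rw [← div_eq_mul_inv]; exact Nat.cast_div_le
  have h4 : (cyc n a : ℝ)⁻¹ ≤ (a : ℝ)⁻¹ + ((n - a : ℕ) : ℝ)⁻¹ := by
    rcases le_total a (n - a) with h | h
    · rw [show cyc n a = a from min_eq_left h]
      exact le_add_of_nonneg_right (by positivity)
    · rw [show cyc n a = n - a from min_eq_right h]
      exact le_add_of_nonneg_left (by positivity)
  calc (((Finset.range n).filter fun b => cyc n a * cyc n b < n).card : ℝ)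
      ≤ 3 * (n / cyc n a : ℕ) := by exact_mod_cast h2
    _ ≤ 3 * (n * (cyc n a : ℝ)⁻¹) := by gcongr
    _ ≤ 3 * (n * ((a : ℝ)⁻¹ + ((n - a : ℕ) : ℝ)⁻¹)) := by gcongr
    _ = _ := by ring

lemma card_pairs_le (n : ℕ) :
    (((Finset.range n ×ˢ Finset.range n).filter fun p => cyc n p.1 * cyc n p.2 < n).card : ℝ) ≤
      7 * n * (1 + Real.log n) := by
  rcases Nat.eq_zero_or_pos n with rfl | hn
  · simp
  have hlog : 0 ≤ Real.log n := Real.log_nonneg (by exact_mod_cast hn)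
  have h1 : ((Finset.range n ×ˢ Finset.range n).filter fun p => cyc n p.1 * cyc n p.2 < n).card =
      ∑ a ∈ Finset.range n, ((Finset.range n).filter fun b => cyc n a * cyc n b < n).card := by
    simp only [Finset.card_filter]
    rw [Finset.sum_product]
  obtain ⟨k, rfl⟩ : ∃ k, n = k + 1 := ⟨n - 1, by omega⟩
  have hinv : ∑ a ∈ Finset.range k, (((a + 1 : ℕ) : ℝ)⁻¹ + ((k + 1 - (a + 1) : ℕ) : ℝ)⁻¹) ≤
      2 * (1 + Real.log (k + 1 : ℕ)) := by
    have e1 : ∑ a ∈ Finset.range k, ((k + 1 - (a + 1) : ℕ) : ℝ)⁻¹ =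
        ∑ a ∈ Finset.range k, ((a + 1 : ℕ) : ℝ)⁻¹ := by
      rw [← Finset.sum_range_reflect]
      refine Finset.sum_congr rfl fun a ha => ?_
      rw [Finset.mem_range] at ha
      congr 2
      omega
    have e2 := harmonic_le_one_add_log (k + 1)
    rw [harmonic] at e2
    push_cast at e2
    rw [Finset.sum_range_succ] at e2
    rw [Finset.sum_add_distrib, e1]
    push_cast
    have : 0 ≤ ((k : ℝ) + 1)⁻¹ := by positivity
    linarith
  rw [h1, Nat.cast_sum, Finset.sum_range_succ']
  -- The row `a = 0` counts entirely; it is the extra `n` beside the two harmonic sums.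
  have h2 : (((Finset.range (k + 1)).filter fun b => cyc (k + 1) 0 * cyc (k + 1) b < k + 1).card : ℝ)
      ≤ (k + 1 : ℕ) := by
    exact_mod_cast (Finset.card_filter_le _ _).trans (Finset.card_range _).le
  have h3 := Finset.sum_le_sum fun a (ha : a ∈ Finset.range k) =>
    card_cyc_mul_lt_le (n := k + 1) (a := a + 1) (by omega) (by rw [Finset.mem_range] at ha; omega)
  rw [← Finset.mul_sum] at h3
  have h4 := mul_le_mul_of_nonneg_left hinv (by positivity : (0 : ℝ) ≤ 3 * (k + 1 : ℕ))
  have h5 : 0 ≤ ((k + 1 : ℕ) : ℝ) * Real.log (k + 1 : ℕ) := by positivity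
  linarith

variable {c C K : ℝ} (n : ℕ) [NeZero n]
  (hopt : ∀ x y : ℕ, x < n → y < n → n ≤ cyc n x * cyc n y → IsOptimal c C K n x y)
include hopt

lemma nonOptimalCount_le :
    (nonOptimalCount c C K n : ℝ) ≤ 14 * (n * Real.log ((n : ℝ) ^ 2)) := by
  rcases Nat.lt_or_ge n 2 with h | h
  · have h1 : {p : ℕ × ℕ | p.1 < n ∧ p.2 < n ∧ p ≠ (0, 0) ∧ ¬ IsOptimal c C K n p.1 p.2} = ∅ := by
      rw [Set.eq_empty_iff_forall_notMem]
      rintro ⟨x, y⟩ ⟨h1, h2, h3, -⟩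
      apply h3
      simp only [Prod.mk.injEq] at h1 h2 ⊢
      omega
    have h2 : n = 1 := by have := NeZero.pos n; omega
    rw [nonOptimalCount, h1, Set.ncard_empty, h2]
    simp
  · have h1 : nonOptimalCount c C K n ≤
        ((Finset.range n ×ˢ Finset.range n).filter fun p => cyc n p.1 * cyc n p.2 < n).card := by
      rw [nonOptimalCount, ← Set.ncard_coe_finset]
      refine Set.ncard_le_ncard ?_ (Finset.finite_toSet _)
      rintro ⟨x, y⟩ ⟨h1, h2, -, h3⟩
      simp only [Finset.coe_filter, Finset.mem_product, Finset.mem_range, Set.mem_ofPred_eq]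
      exact ⟨⟨h1, h2⟩, not_le.mp fun h4 => h3 (hopt x y h1 h2 h4)⟩
    have h2 := one_le_log_sq (n := n) h
    have h3 := card_pairs_le n
    have h4 : (nonOptimalCount c C K n : ℝ) ≤ 7 * n * (1 + Real.log n) :=
      le_trans (by exact_mod_cast h1) h3
    have hn : (0 : ℝ) < n := Nat.cast_pos.mpr (NeZero.pos n)
    rw [log_sq_eq] at h2 ⊢
    nlinarith

lemma nonOptimalCount_le_mul {ε : ℝ} (hε : 0 < ε) (hn : ⌈(112 / ε) ^ 2⌉₊ + 2 ≤ n) :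
    (nonOptimalCount c C K n : ℝ) ≤ ε * ((n : ℝ) ^ 2 - 1) := by
  refine (nonOptimalCount_le n hopt).trans ?_
  have hn2 : (2 : ℝ) ≤ n := by exact_mod_cast (by omega : 2 ≤ n)
  have hn1 : (112 / ε) ^ 2 ≤ n := (Nat.le_ceil _).trans (by exact_mod_cast (by omega))
  -- From `log n ≤ 2 √n` the count is at most `56 n √n`, and `n² - 1 ≥ n² / 2`; hence 112.
  have h1 : 112 / ε ≤ Real.sqrt n := Real.le_sqrt_of_sq_le hn1
  have hs : Real.sqrt n ^ 2 = n := Real.sq_sqrt (by linarith)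
  have hs0 : 0 < Real.sqrt n := Real.sqrt_pos.mpr (by linarith)
  have h2 : Real.log n ≤ 2 * Real.sqrt n := by
    have := Real.log_le_sub_one_of_pos hs0
    rw [Real.log_sqrt (by linarith)] at this
    linarith
  rw [div_le_iff₀ hε] at h1
  rw [log_sq_eq]
  calc 14 * (n * (2 * Real.log n)) ≤ 14 * (n * (2 * (2 * Real.sqrt n))) := by gcongr
    _ = 112 * (n * Real.sqrt n) / 2 := by ring
    _ ≤ (Real.sqrt n * ε) * (n * Real.sqrt n) / 2 := by gcongr
    _ = ε * (n * Real.sqrt n ^ 2 / 2) := by ring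
    _ ≤ _ := by
      rw [hs]
      refine mul_le_mul_of_nonneg_left ?_ hε.le
      nlinarith

end Counting

end QWSearch

end

theorem mainTheorem1 :
    ∃ c C K D : ℝ, 0 < c ∧ 0 < C ∧ 0 < K ∧ 0 < D ∧
      (∀ n x y : ℕ, 0 < x → x < n → 0 < y → y < n →
        |QWSearch.interference n x y| ≤
          D * ((n : ℝ) ^ 2 / ((QWSearch.cyc n x : ℝ) * (QWSearch.cyc n y : ℝ)))) ∧
      (∀ (n : ℕ) [NeZero n] (x y : ℕ), x < n → y < n →
        n ≤ QWSearch.cyc n x * QWSearch.cyc n y → QWSearch.IsOptimal c C K n x y) ∧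
      (∀ (n : ℕ) [NeZero n],
        (QWSearch.nonOptimalCount c C K n : ℝ) ≤
          D * (Real.sqrt ((n : ℝ) ^ 2) * Real.log ((n : ℝ) ^ 2))) ∧
      (∀ ε : ℝ, 0 < ε → ∃ n₀ : ℕ, ∀ (n : ℕ) [NeZero n], n₀ ≤ n →
        (QWSearch.nonOptimalCount c C K n : ℝ) ≤ ε * ((n : ℝ) ^ 2 - 1)) := by
  -- `D = 192` comes from the interference bound and exceeds the 14 of the count.
  refine ⟨(1 / 2568) ^ 2, 3000, 16, 192, by norm_num, by norm_num, by norm_num, by norm_num,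
    ?_, ?_, ?_, ?_⟩
  · intro n x y hx0 hxn hy0 hyn
    have : NeZero n := ⟨by omega⟩
    exact QWSearch.abs_interference_le hx0 hxn hy0 hyn
  · intro n _ x y hxn hyn hxy
    exact QWSearch.isOptimal hxn hyn hxy
  · intro n _
    have hn : (1 : ℝ) ≤ n := by exact_mod_cast NeZero.one_le (n := n)
    have h := QWSearch.nonOptimalCount_le n (c := (1 / 2568) ^ 2) (C := 3000) (K := 16)
      fun x y hx hy hxy => QWSearch.isOptimal hx hy hxy
    rw [Real.sqrt_sq (by linarith)]
    have h2 : 0 ≤ (n : ℝ) * Real.log ((n : ℝ) ^ 2) :=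
      mul_nonneg (by linarith) (Real.log_nonneg (one_le_pow₀ hn))
    linarith
  · intro ε hε
    exact ⟨_, fun n _ hn => QWSearch.nonOptimalCount_le_mul n
      (fun x y hx hy hxy => QWSearch.isOptimal hx hy hxy) hε hn⟩
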